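/- Let $k$ be an algebraically closed field of characteristic $0$, let $C_n$ denote the cyclic group of order $n$, and let $H=k[C_2]$ be the group Hopf algebra of $C_2=\langle g\rangle$ (an ordinary Hopf algebra, with trivial reassociator); put $p_\pm=\frac12(1\pm g)$. Let ${}_H^H\mathcal{YD}$ be the braided category of left Yetter–Drinfeld modules over $H$: left $H$-modules and left $H$-comodules $M$, with coaction $m\mapsto m_{[-1]}\otimes m_{[0]}$, such that $h_1m_{[-1]}\otimes h_2\cdot m_{[0]}=(h_1\cdot m)_{[-1]}h_2\otimes (h_1\cdot m)_{[0]}$, with braiding $m\otimes n\mapsto m_{[-1]}\cdot n\otimes m_{[0]}$. A braided Hopf algebra is a Hopf algebra in ${}_H^H\mathcal{YD}$; an isomorphism of braided Hopf algebras is an isomorphism of algebras and coalgebras that is $H$-linear and $H$-colinear and commutes with the antipodes. If $B$ is a braided Hopf algebra in ${}_H^H\mathcal{YD}$ with $\dim_k B=3$, then $B$ is isomorphic to one of the following three braided Hopf algebras, each of which is, as an algebra and a coalgebra and with its antipode, the group Hopf algebra $k[C_3]$, $C_3=\langle x\rangle$: - $B_{C_6}$, with the trivial $H$-action $h\cdot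 b=\varepsilon(h)b$ and the trivial $H$-coaction $b\mapsto 1\otimes b$; - $B_{S_3}$, with the $H$-action determined by $g\cdot x^i=x^{2i}$ and the trivial $H$-coaction; - $B_*$, with the trivial $H$-action and the $H$-coaction $\lambda(x^i)=p_+\otimes x^i+p_-\otimes x^{2i}$, $0\le i\le 2$. Moreover, for a braided Hopf algebra $B$ let $B\times H$ be the biproduct Hopf algebra: the vector space $B\otimes H$ with unit $1\otimes 1$, counit $\underline\varepsilon_B\otimes\varepsilon$, multiplication $(b\otimes h)(b'\otimes h')=b(h_1\cdot b')\otimes h_2h'$, comultiplication $b\otimes h\mapsto (b_{1}\otimes (b_{2})_{[-1]}h_1)\otimes((b_{2})_{[0]}\otimes h_2)$ and antipode $b\otimes h\mapsto (1\otimes S(b_{[-1]}h))(\underline S_B(b_{[0]})\otimes 1)$. Then, as Hopf algebras, $B_{C_6}\times H\cong k[C_6]$, $B_{S_3}\times H\cong k[S_3]$ and $B_*\times H\cong k^{S_3}$, the dual Hopf algebra of $k[S_3]$. -/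

import Mathlib

open TensorProduct

noncomputable section

namespace YD

universe u v w

/-! ### Yetter-Drinfeld modules over a Hopf algebra -/

section Modules

variable {k H M N P : Type*} [Field k] [Ring H] [Algebra k H]
  [AddCommGroup M] [Module k M] [AddCommGroup N] [Module k N] [AddCommGroup P] [Module k P]

/-- The action map `H ⊗ M → M`, `h ⊗ m ↦ h · m`, of a representation `H → End M`. -/
def actMap (act : H →ₐ[k] Module.End k M) : H ⊗[k] M →ₗ[k] M :=
  TensorProduct.lift act.toLinearMap

/-- For a left coaction `ρ : M → H ⊗ M` and a left action `α : H ⊗ N → N`, the map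
`M ⊗ N → N ⊗ M`, `m ⊗ n ↦ (m₍₋₁₎ · n) ⊗ m₍₀₎`. -/
def crossMap (ρ : M →ₗ[k] H ⊗[k] M) (α : H ⊗[k] N →ₗ[k] N) : M ⊗[k] N →ₗ[k] N ⊗[k] M :=
  α.rTensor M ∘ₗ (TensorProduct.rightComm k H M N).toLinearMap ∘ₗ ρ.rTensor N

/-- Apply a linear map `c : N ⊗ P → P ⊗ N` to the two inner factors:
`(M ⊗ N) ⊗ (P ⊗ Q) → (M ⊗ P) ⊗ (N ⊗ Q)`. -/
def middle {Q : Type*} [AddCommGroup Q] [Module k Q] (c : N ⊗[k] P →ₗ[k] P ⊗[k] N) :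
    (M ⊗[k] N) ⊗[k] (P ⊗[k] Q) →ₗ[k] (M ⊗[k] P) ⊗[k] (N ⊗[k] Q) :=
  (TensorProduct.tensorTensorTensorAssoc k M P N Q).symm.toLinearMap ∘ₗ
    (c.lTensor M).rTensor Q ∘ₗ (TensorProduct.tensorTensorTensorAssoc k M N P Q).toLinearMap

end Modules

variable (k : Type u) [Field k] (H : Type v) [Ring H] [HopfAlgebra k H]

/-- A left Yetter-Drinfeld module structure over the Hopf algebra `H` on the vector space `M`:
a left `H`-action and a left `H`-coaction `m ↦ m₍₋₁₎ ⊗ m₍₀₎` such that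
`h₁ m₍₋₁₎ ⊗ h₂ · m₍₀₎ = (h₁ · m)₍₋₁₎ h₂ ⊗ (h₁ · m)₍₀₎`. -/
structure YDModule (M : Type w) [AddCommGroup M] [Module k M] where
  act : H →ₐ[k] Module.End k M
  coact : M →ₗ[k] H ⊗[k] M
  coact_counit : (TensorProduct.lid k M).toLinearMap ∘ₗ
    (Coalgebra.counit (R := k) (A := H)).rTensor M ∘ₗ coact = LinearMap.id
  coact_coassoc : (TensorProduct.assoc k H H M).toLinearMap ∘ₗ
    (Coalgebra.comul (R := k) (A := H)).rTensor M ∘ₗ coact = coact.lTensor H ∘ₗ coact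
  compat :
    TensorProduct.map (LinearMap.mul' k H) (actMap act) ∘ₗ
        (TensorProduct.tensorTensorTensorComm k H H H M).toLinearMap ∘ₗ
        TensorProduct.map Coalgebra.comul coact =
      (LinearMap.mul' k H).rTensor M ∘ₗ (TensorProduct.rightComm k H M H).toLinearMap ∘ₗ
        (coact ∘ₗ actMap act).rTensor H ∘ₗ (TensorProduct.rightComm k H H M).toLinearMap ∘ₗ
        (Coalgebra.comul (R := k) (A := H)).rTensor M

namespace YDModule

variable {k H} {M N : Type*} [AddCommGroup M] [Module k M] [AddCommGroup N] [Module k N]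

/-- The diagonal action `h · (m ⊗ n) = h₁ · m ⊗ h₂ · n` on the tensor product. -/
def tensorAct (V : YDModule k H M) (W : YDModule k H N) :
    H ⊗[k] (M ⊗[k] N) →ₗ[k] M ⊗[k] N :=
  TensorProduct.map (actMap V.act) (actMap W.act) ∘ₗ
    (TensorProduct.tensorTensorTensorComm k H H M N).toLinearMap ∘ₗ
    (Coalgebra.comul (R := k) (A := H)).rTensor (M ⊗[k] N)

/-- The codiagonal coaction `m ⊗ n ↦ m₍₋₁₎ n₍₋₁₎ ⊗ (m₍₀₎ ⊗ n₍₀₎)` on the tensor product. -/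
def tensorCoact (V : YDModule k H M) (W : YDModule k H N) :
    M ⊗[k] N →ₗ[k] H ⊗[k] (M ⊗[k] N) :=
  (LinearMap.mul' k H).rTensor (M ⊗[k] N) ∘ₗ
    (TensorProduct.tensorTensorTensorComm k H M H N).toLinearMap ∘ₗ
    TensorProduct.map V.coact W.coact

/-- The braiding `m ⊗ n ↦ (m₍₋₁₎ · n) ⊗ m₍₀₎` of the category of Yetter-Drinfeld modules. -/
def braiding (V : YDModule k H M) (W : YDModule k H N) : M ⊗[k] N →ₗ[k] N ⊗[k] M :=
  crossMap V.coact (actMap W.act)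

end YDModule

/-! ### Braided Hopf algebras -/

/-- The structure of a Hopf algebra in the braided category of left Yetter-Drinfeld modules
over `H`, on a vector space `B` which is given as an associative unital algebra and as a
coassociative counital coalgebra. -/
structure BraidedHopfAlgebra (B : Type w) [Ring B] [Algebra k B] [Coalgebra k B]
    extends YDModule k H B where
  /-- the multiplication is `H`-linear -/
  act_mul : LinearMap.mul' k B ∘ₗ toYDModule.tensorAct toYDModule =
    actMap act ∘ₗ (LinearMap.mul' k B).lTensor H
  /-- the unit is `H`-linear -/
  act_one : ∀ h : H, act h 1 = Coalgebra.counit (R := k) h • (1 : B)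
  /-- the multiplication is `H`-colinear -/
  coact_mul : coact ∘ₗ LinearMap.mul' k B =
    (LinearMap.mul' k B).lTensor H ∘ₗ toYDModule.tensorCoact toYDModule
  /-- the unit is `H`-colinear -/
  coact_one : coact 1 = (1 : H) ⊗ₜ[k] (1 : B)
  /-- the comultiplication is `H`-linear -/
  comul_act : Coalgebra.comul ∘ₗ actMap act =
    toYDModule.tensorAct toYDModule ∘ₗ (Coalgebra.comul (R := k) (A := B)).lTensor H
  /-- the counit is `H`-linear -/
  counit_act : ∀ (h : H) (b : B),
    Coalgebra.counit (R := k) (act h b) = Coalgebra.counit (R := k) h * Coalgebra.counit b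
  /-- the comultiplication is `H`-colinear -/
  comul_coact : (Coalgebra.comul (R := k) (A := B)).lTensor H ∘ₗ coact =
    toYDModule.tensorCoact toYDModule ∘ₗ Coalgebra.comul
  /-- the counit is `H`-colinear -/
  counit_coact : ∀ b : B, TensorProduct.rid k H
    ((Coalgebra.counit (R := k) (A := B)).lTensor H (coact b)) =
      Coalgebra.counit (R := k) b • (1 : H)
  comul_one : Coalgebra.comul (R := k) (1 : B) = 1 ⊗ₜ[k] 1
  counit_one : Coalgebra.counit (R := k) (1 : B) = 1
  counit_mul : ∀ a b : B, Coalgebra.counit (R := k) (a * b) =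
    Coalgebra.counit a * Coalgebra.counit b
  /-- the comultiplication is multiplicative for the braided tensor product algebra `B ⊗ B`:
  `Δ(ab) = a₁ (a₂₍₋₁₎ · b₁) ⊗ a₂₍₀₎ b₂` -/
  comul_mul : Coalgebra.comul ∘ₗ LinearMap.mul' k B =
    TensorProduct.map (LinearMap.mul' k B) (LinearMap.mul' k B) ∘ₗ
      middle (toYDModule.braiding toYDModule) ∘ₗ
      TensorProduct.map (Coalgebra.comul (R := k) (A := B)) (Coalgebra.comul (R := k) (A := B))
  antipode : B →ₗ[k] B
  antipode_act : ∀ (h : H) (b : B), antipode (act h b) = act h (antipode b)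
  antipode_coact : coact ∘ₗ antipode = antipode.lTensor H ∘ₗ coact
  antipode_left : LinearMap.mul' k B ∘ₗ antipode.rTensor B ∘ₗ Coalgebra.comul =
    Algebra.linearMap k B ∘ₗ Coalgebra.counit
  antipode_right : LinearMap.mul' k B ∘ₗ antipode.lTensor B ∘ₗ Coalgebra.comul =
    Algebra.linearMap k B ∘ₗ Coalgebra.counit

variable {k H}

/-- Isomorphisms of braided Hopf algebras: linear bijections which respect the algebra and
coalgebra structures, the antipodes, the `H`-actions and the `H`-coactions. -/
structure BraidedHopfAlgebra.Iso {B : Type*} [Ring B] [Algebra k B] [Coalgebra k B]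
    {B' : Type*} [Ring B'] [Algebra k B'] [Coalgebra k B']
    (S : BraidedHopfAlgebra k H B) (T : BraidedHopfAlgebra k H B') extends B ≃ₐ[k] B' where
  map_comul : ∀ b : B, Coalgebra.comul (R := k) (toAlgEquiv b) =
    TensorProduct.map toAlgEquiv.toLinearMap toAlgEquiv.toLinearMap (Coalgebra.comul (R := k) b)
  map_counit : ∀ b : B, Coalgebra.counit (R := k) (toAlgEquiv b) = Coalgebra.counit (R := k) b
  map_antipode : ∀ b : B, toAlgEquiv (S.antipode b) = T.antipode (toAlgEquiv b)
  map_act : ∀ (h : H) (b : B), toAlgEquiv (S.act h b) = T.act h (toAlgEquiv b)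
  map_coact : ∀ b : B, T.coact (toAlgEquiv b) = toAlgEquiv.toLinearMap.lTensor H (S.coact b)

/-! ### The operations of a Hopf algebra, duals and biproducts -/

variable (k) in
/-- The five structure maps of a Hopf algebra on the vector space `A`. It is only used to
write down the explicit structure maps of particular Hopf algebras. -/
structure HopfOps (A : Type w) [AddCommGroup A] [Module k A] where
  mul : A ⊗[k] A →ₗ[k] A
  one : A
  comul : A →ₗ[k] A ⊗[k] A
  counit : A →ₗ[k] k
  antipode : A →ₗ[k] A

/-- `e` is an isomorphism of Hopf algebras: it respects all the structure maps. -/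
structure HopfOps.IsIso {A A' : Type*} [AddCommGroup A] [Module k A] [AddCommGroup A']
    [Module k A'] (S : HopfOps k A) (T : HopfOps k A') (e : A ≃ₗ[k] A') : Prop where
  map_mul : ∀ x y : A, e (S.mul (x ⊗ₜ y)) = T.mul (e x ⊗ₜ e y)
  map_one : e S.one = T.one
  map_comul : ∀ x : A, T.comul (e x) = TensorProduct.map e.toLinearMap e.toLinearMap (S.comul x)
  map_counit : ∀ x : A, T.counit (e x) = S.counit x
  map_antipode : ∀ x : A, e (S.antipode x) = T.antipode (e x)

/-- Two sets of Hopf algebra structure maps are isomorphic. -/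
def HopfOps.Isomorphic {A A' : Type*} [AddCommGroup A] [Module k A] [AddCommGroup A']
    [Module k A'] (S : HopfOps k A) (T : HopfOps k A') : Prop :=
  ∃ e : A ≃ₗ[k] A', S.IsIso T e

variable (k) in
/-- The structure maps of a Hopf algebra. -/
def HopfOps.ofHopf (A : Type*) [Ring A] [HopfAlgebra k A] : HopfOps k A where
  mul := LinearMap.mul' k A
  one := 1
  comul := Coalgebra.comul
  counit := Coalgebra.counit
  antipode := HopfAlgebra.antipode k

variable (k) in
/-- The structure maps of the dual Hopf algebra of a finite dimensional Hopf algebra `A`: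
`(f * g)(a) = f(a₁) g(a₂)`, the unit is `ε`, `Δ(f)(a ⊗ b) = f(ab)`, the counit is `f ↦ f(1)`
and the antipode is `f ↦ f ∘ S`. -/
def HopfOps.dual (A : Type*) [Ring A] [HopfAlgebra k A] [Module.Finite k A] :
    HopfOps k (Module.Dual k A) where
  mul := (Coalgebra.comul (R := k) (A := A)).dualMap ∘ₗ TensorProduct.dualDistrib k A A
  one := Coalgebra.counit
  comul := (TensorProduct.dualDistribEquiv k A A).symm.toLinearMap ∘ₗ
    (LinearMap.mul' k A).dualMap
  counit := Module.Dual.eval k A 1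
  antipode := (HopfAlgebra.antipode k (A := A)).dualMap

section Biproduct

variable {B : Type*} [Ring B] [Algebra k B] [Coalgebra k B] (S : BraidedHopfAlgebra k H B)

/-- The smash product `(b # h)(b' # h') = b (h₁ · b') # h₂ h'`. -/
def smashMul : (B ⊗[k] H) ⊗[k] (B ⊗[k] H) →ₗ[k] B ⊗[k] H :=
  TensorProduct.map (LinearMap.mul' k B) (LinearMap.mul' k H) ∘ₗ
    middle (crossMap Coalgebra.comul (actMap S.act))

/-- The smash coproduct `b ⊗ h ↦ (b₁ ⊗ b₂₍₋₁₎ h₁) ⊗ (b₂₍₀₎ ⊗ h₂)`. -/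
def smashComul : B ⊗[k] H →ₗ[k] (B ⊗[k] H) ⊗[k] (B ⊗[k] H) :=
  middle (crossMap S.coact (LinearMap.mul' k H)) ∘ₗ
    TensorProduct.map Coalgebra.comul Coalgebra.comul

/-- The biproduct `B × H`: the vector space `B ⊗ H` with the smash product, the smash coproduct
and the antipode `b ⊗ h ↦ (1 ⊗ S(b₍₋₁₎ h)) (S_B(b₍₀₎) ⊗ 1)`. -/
def biproduct : HopfOps k (B ⊗[k] H) where
  mul := smashMul S
  one := 1 ⊗ₜ[k] 1
  comul := smashComul S
  counit := (TensorProduct.lid k k).toLinearMap ∘ₗ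
    TensorProduct.map Coalgebra.counit Coalgebra.counit
  antipode := smashMul S ∘ₗ
    TensorProduct.map (TensorProduct.mk k B H 1 ∘ₗ HopfAlgebra.antipode k)
      ((TensorProduct.mk k B H).flip 1 ∘ₗ S.antipode) ∘ₗ
    crossMap S.coact (LinearMap.mul' k H)

end Biproduct

/-! ### The three braided Hopf algebras -/

variable (k)

/-- The cyclic group of order `n`, written multiplicatively. -/
abbrev C (n : ℕ) : Type := Multiplicative (ZMod n)

/-- The group Hopf algebra of the group `G` over the field `k`. -/
abbrev GA (G : Type) : Type u := MonoidAlgebra k G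

/-- The generator `g` of the cyclic group of order two. -/
abbrev g : C 2 := Multiplicative.ofAdd 1

/-- The idempotent `p₊ = (1 + g) / 2` of `k[C₂]`. -/
def pPlus : GA k (C 2) := (2⁻¹ : k) • (1 + MonoidAlgebra.of k (C 2) g)

/-- The idempotent `p₋ = (1 - g) / 2` of `k[C₂]`. -/
def pMinus : GA k (C 2) := (2⁻¹ : k) • (1 - MonoidAlgebra.of k (C 2) g)

/-- The linear map of `k[C₃]` with `xⁱ ↦ x²ⁱ`. -/
def sq : GA k (C 3) →ₗ[k] GA k (C 3) :=
  MonoidAlgebra.mapDomainLinearMap k k fun a => a ^ 2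

/-- The trivial action `h · b = ε(h) b` of `k[C₂]` on `k[C₃]`. -/
def trivialAct : GA k (C 2) →ₐ[k] Module.End k (GA k (C 3)) :=
  (Algebra.ofId k (Module.End k (GA k (C 3)))).comp (Bialgebra.counitAlgHom k (GA k (C 2)))

/-- The trivial coaction `b ↦ 1 ⊗ b` of `k[C₂]` on `k[C₃]`. -/
def trivialCoact : GA k (C 3) →ₗ[k] GA k (C 2) ⊗[k] GA k (C 3) :=
  TensorProduct.mk k (GA k (C 2)) (GA k (C 3)) 1

theorem sq_mul_sq : sq k * sq k = 1 := by
  apply MonoidAlgebra.lhom_ext'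
  intro a
  ext
  have : (a ^ 2) ^ 2 = a := by revert a; decide
  simp [sq, this]

/-- The action of `k[C₂]` on `k[C₃]` in which `g · xⁱ = x²ⁱ`. -/
def sqAct : GA k (C 2) →ₐ[k] Module.End k (GA k (C 3)) :=
  MonoidAlgebra.lift k (Module.End k (GA k (C 3))) (C 2)
    { toFun := fun c => if c = 1 then 1 else sq k
      map_one' := by simp
      map_mul' := by
        have h : ∀ a b : C 2, a ≠ 1 → b ≠ 1 → a * b = 1 := by decide
        intro a b
        by_cases ha : a = 1
        · simp [ha]
        · by_cases hb : b = 1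
          · simp [hb]
          · simp [ha, hb, h a b ha hb, sq_mul_sq] }

/-- The coaction `xⁱ ↦ p₊ ⊗ xⁱ + p₋ ⊗ x²ⁱ` of `k[C₂]` on `k[C₃]`. -/
def sqCoact : GA k (C 3) →ₗ[k] GA k (C 2) ⊗[k] GA k (C 3) :=
  TensorProduct.mk k (GA k (C 2)) (GA k (C 3)) (pPlus k) +
    TensorProduct.mk k (GA k (C 2)) (GA k (C 3)) (pMinus k) ∘ₗ sq k

theorem lext {M G : Type*} [AddCommGroup M] [Module k M] {f f' : MonoidAlgebra k G →ₗ[k] M}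
    (h : ∀ a, f (MonoidAlgebra.single a 1) = f' (MonoidAlgebra.single a 1)) : f = f' := by
  apply MonoidAlgebra.lhom_ext'
  intro a
  ext
  exact h a

theorem trivialAct_apply (h : GA k (C 2)) (b : GA k (C 3)) :
    trivialAct k h b = Coalgebra.counit (R := k) h • b := by
  simp [trivialAct, Algebra.ofId_apply, Module.algebraMap_end_apply]

theorem trivialCoact_apply (b : GA k (C 3)) : trivialCoact k b = 1 ⊗ₜ[k] b := rfl

theorem sq_single (a : C 3) (r : k) :
    sq k (MonoidAlgebra.single a r) = MonoidAlgebra.single (a ^ 2) r := by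
  simp [sq]

theorem sqAct_single (c : C 2) (a : C 3) :
    sqAct k (MonoidAlgebra.single c 1) (MonoidAlgebra.single a 1) =
      MonoidAlgebra.single (if c = 1 then a else a ^ 2) 1 := by
  by_cases h : c = 1 <;> simp [sqAct, h, sq_single]

theorem sqCoact_single (a : C 3) (r : k) : sqCoact k (MonoidAlgebra.single a r) =
    pPlus k ⊗ₜ[k] MonoidAlgebra.single a r + pMinus k ⊗ₜ[k] MonoidAlgebra.single (a ^ 2) r := by
  simp [sqCoact, sq_single]

theorem sqAct_one (c : C 2) : sqAct k (MonoidAlgebra.single c 1) 1 = 1 := by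
  rw [MonoidAlgebra.one_def, sqAct_single]
  simp

theorem sq_sq (a : C 3) : (a ^ 2) ^ 2 = a := by
  revert a; decide

theorem pPlus_add_pMinus [CharZero k] : pPlus k + pMinus k = 1 := by
  rw [pPlus, pMinus, ← smul_add, add_add_sub_cancel, ← two_smul k (1 : GA k (C 2)), smul_smul]
  norm_num

theorem g_mul_g : MonoidAlgebra.of k (C 2) g * MonoidAlgebra.of k (C 2) g = 1 := by
  rw [← map_mul, show g * g = 1 by decide, map_one]

theorem pPlus_mul_pPlus [CharZero k] : pPlus k * pPlus k = pPlus k := by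
  have h := g_mul_g k
  unfold pPlus
  generalize MonoidAlgebra.of k (C 2) g = y at h ⊢
  simp only [smul_mul_smul_comm, mul_add, add_mul, h, one_mul, mul_one]
  module

theorem pMinus_mul_pMinus [CharZero k] : pMinus k * pMinus k = pMinus k := by
  have h := g_mul_g k
  unfold pMinus
  generalize MonoidAlgebra.of k (C 2) g = y at h ⊢
  simp only [smul_mul_smul_comm, mul_sub, sub_mul, h, one_mul, mul_one]
  module

theorem pPlus_mul_pMinus : pPlus k * pMinus k = 0 := by
  have h := g_mul_g k
  unfold pPlus pMinus
  generalize MonoidAlgebra.of k (C 2) g = y at h ⊢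
  simp only [smul_mul_smul_comm, mul_sub, add_mul, h, one_mul, mul_one]
  module

theorem counit_pPlus [CharZero k] : Coalgebra.counit (R := k) (pPlus k) = 1 := by
  simp [pPlus]
  norm_num

theorem counit_pMinus : Coalgebra.counit (R := k) (pMinus k) = 0 := by
  simp [pMinus]

theorem comul_pPlus [CharZero k] : Coalgebra.comul (R := k) (pPlus k) =
    pPlus k ⊗ₜ[k] pPlus k + pMinus k ⊗ₜ[k] pMinus k := by
  simp only [pPlus, pMinus, map_smul, map_add, Bialgebra.comul_one, MonoidAlgebra.of_apply,
    MonoidAlgebra.comul_single, Algebra.TensorProduct.one_def, CommSemiring.comul_apply,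
    TensorProduct.map_tmul, MonoidAlgebra.lsingle_apply, ← smul_tmul', tmul_smul, tmul_add, add_tmul,
    tmul_sub, sub_tmul]
  module

theorem comul_pMinus [CharZero k] : Coalgebra.comul (R := k) (pMinus k) =
    pPlus k ⊗ₜ[k] pMinus k + pMinus k ⊗ₜ[k] pPlus k := by
  simp only [pPlus, pMinus, map_smul, map_sub, Bialgebra.comul_one, MonoidAlgebra.of_apply,
    MonoidAlgebra.comul_single, Algebra.TensorProduct.one_def, CommSemiring.comul_apply,
    TensorProduct.map_tmul, MonoidAlgebra.lsingle_apply, ← smul_tmul', tmul_smul, tmul_add, add_tmul,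
    tmul_sub, sub_tmul]
  module

attribute [local simp] YDModule.tensorAct YDModule.tensorCoact YDModule.braiding middle crossMap
  actMap trivialAct_apply trivialCoact_apply sqAct_single sqCoact_single sq_single sqAct_one
  Algebra.TensorProduct.one_def

/-- `k[C₃]` with the trivial action and the trivial coaction of `k[C₂]`. -/
def BC6 : BraidedHopfAlgebra k (GA k (C 2)) (GA k (C 3)) where
  act := trivialAct k
  coact := trivialCoact k
  coact_counit := by
    refine lext k fun a => ?_
    simp
  coact_coassoc := by
    refine lext k fun a => ?_
    simp
  compat := by
    refine TensorProduct.ext (lext k fun c => lext k fun a => ?_)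
    simp
  act_mul := by
    refine TensorProduct.ext (lext k fun c => TensorProduct.ext (lext k fun a => lext k fun b => ?_))
    simp
  act_one := by
    intro h
    refine LinearMap.congr_fun (f := LinearMap.flip (trivialAct k).toLinearMap 1) (g := LinearMap.smulRight Coalgebra.counit 1) (lext k fun a => ?_) h
    simp
  coact_mul := by
    refine TensorProduct.ext (lext k fun a => lext k fun b => ?_)
    simp
  coact_one := by
    rw [MonoidAlgebra.one_def]
    simp
  comul_act := by
    refine TensorProduct.ext (lext k fun c => lext k fun a => ?_)
    simp
  counit_act := by
    refine fun h b => LinearMap.congr_fun (LinearMap.congr_fun (f := ((trivialAct k).toLinearMap.compr₂ Coalgebra.counit)) (g := (LinearMap.mul k k).compl₁₂ Coalgebra.counit Coalgebra.counit) (lext k fun c => lext k fun a => ?_) h) b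
    simp
  comul_coact := by
    refine lext k fun a => ?_
    simp
  counit_coact := by
    refine fun b => LinearMap.congr_fun (f := (TensorProduct.rid k _).toLinearMap ∘ₗ (Coalgebra.counit (R := k) (A := GA k (C 3))).lTensor _ ∘ₗ trivialCoact k) (g := LinearMap.smulRight Coalgebra.counit 1) (lext k fun a => ?_) b
    simp
  comul_one := by
    rw [MonoidAlgebra.one_def]
    simp
  counit_one := by
    rw [MonoidAlgebra.one_def]
    simp
  counit_mul := Bialgebra.counit_mul
  comul_mul := by
    refine TensorProduct.ext (lext k fun a => lext k fun b => ?_)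
    simp
  antipode := HopfAlgebra.antipode k
  antipode_act := by
    refine fun h b => LinearMap.congr_fun (LinearMap.congr_fun (f := ((trivialAct k).toLinearMap.compr₂ (HopfAlgebra.antipode k))) (g := (trivialAct k).toLinearMap.compl₂ (HopfAlgebra.antipode k)) (lext k fun c => lext k fun a => ?_) h) b
    simp
  antipode_coact := by
    refine lext k fun a => ?_
    simp
  antipode_left := by
    refine lext k fun a => ?_
    simp
  antipode_right := by
    refine lext k fun a => ?_
    simp

/-- `k[C₃]` with the action `g · xⁱ = x²ⁱ` and the trivial coaction of `k[C₂]`. -/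
def BS3 : BraidedHopfAlgebra k (GA k (C 2)) (GA k (C 3)) where
  act := sqAct k
  coact := trivialCoact k
  coact_counit := by
    refine lext k fun a => ?_
    simp
  coact_coassoc := by
    refine lext k fun a => ?_
    simp
  compat := by
    refine TensorProduct.ext (lext k fun c => lext k fun a => ?_)
    simp
  act_mul := by
    refine TensorProduct.ext (lext k fun c => TensorProduct.ext (lext k fun a => lext k fun b => ?_))
    simp
    split_ifs <;> simp [mul_pow]
  act_one := by
    intro h
    refine LinearMap.congr_fun (f := LinearMap.flip (sqAct k).toLinearMap 1) (g := LinearMap.smulRight Coalgebra.counit 1) (lext k fun a => ?_) h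
    simp
  coact_mul := by
    refine TensorProduct.ext (lext k fun a => lext k fun b => ?_)
    simp
  coact_one := by
    rw [MonoidAlgebra.one_def]
    simp
  comul_act := by
    refine TensorProduct.ext (lext k fun c => lext k fun a => ?_)
    simp
  counit_act := by
    refine fun h b => LinearMap.congr_fun (LinearMap.congr_fun (f := ((sqAct k).toLinearMap.compr₂ Coalgebra.counit)) (g := (LinearMap.mul k k).compl₁₂ Coalgebra.counit Coalgebra.counit) (lext k fun c => lext k fun a => ?_) h) b
    simp
  comul_coact := by
    refine lext k fun a => ?_
    simp
  counit_coact := by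
    refine fun b => LinearMap.congr_fun (f := (TensorProduct.rid k _).toLinearMap ∘ₗ (Coalgebra.counit (R := k) (A := GA k (C 3))).lTensor _ ∘ₗ trivialCoact k) (g := LinearMap.smulRight Coalgebra.counit 1) (lext k fun a => ?_) b
    simp
  comul_one := by
    rw [MonoidAlgebra.one_def]
    simp
  counit_one := by
    rw [MonoidAlgebra.one_def]
    simp
  counit_mul := Bialgebra.counit_mul
  comul_mul := by
    refine TensorProduct.ext (lext k fun a => lext k fun b => ?_)
    simp
  antipode := HopfAlgebra.antipode k
  antipode_act := by
    refine fun h b => LinearMap.congr_fun (LinearMap.congr_fun (f := ((sqAct k).toLinearMap.compr₂ (HopfAlgebra.antipode k))) (g := (sqAct k).toLinearMap.compl₂ (HopfAlgebra.antipode k)) (lext k fun c => lext k fun a => ?_) h) b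
    simp
    split_ifs <;> simp [mul_pow]
  antipode_coact := by
    refine lext k fun a => ?_
    simp
  antipode_left := by
    refine lext k fun a => ?_
    simp
  antipode_right := by
    refine lext k fun a => ?_
    simp

attribute [local simp] sq_sq pPlus_mul_pPlus pMinus_mul_pMinus pPlus_mul_pMinus counit_pPlus
  counit_pMinus comul_pPlus comul_pMinus tmul_add add_tmul mul_pow

theorem pMinus_mul_pPlus : pMinus k * pPlus k = 0 := by
  rw [mul_comm, pPlus_mul_pMinus]

attribute [local simp] pMinus_mul_pPlus

/-- `k[C₃]` with the trivial action and the coaction `xⁱ ↦ p₊ ⊗ xⁱ + p₋ ⊗ x²ⁱ` of `k[C₂]`. -/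
def BStar [CharZero k] : BraidedHopfAlgebra k (GA k (C 2)) (GA k (C 3)) where
  act := trivialAct k
  coact := sqCoact k
  coact_counit := by
    refine lext k fun a => ?_
    simp
  coact_coassoc := by
    refine lext k fun a => ?_
    simp
    abel
  compat := by
    refine TensorProduct.ext (lext k fun c => lext k fun a => ?_)
    simp
    simp only [mul_comm]
  act_mul := by
    refine TensorProduct.ext (lext k fun c => TensorProduct.ext (lext k fun a => lext k fun b => ?_))
    simp
  act_one := by
    intro h
    refine LinearMap.congr_fun (f := LinearMap.flip (trivialAct k).toLinearMap 1) (g := LinearMap.smulRight Coalgebra.counit 1) (lext k fun a => ?_) h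
    simp
  coact_mul := by
    refine TensorProduct.ext (lext k fun a => lext k fun b => ?_)
    simp
  coact_one := by
    rw [← pPlus_add_pMinus]
    rw [MonoidAlgebra.one_def]
    simp
  comul_act := by
    refine TensorProduct.ext (lext k fun c => lext k fun a => ?_)
    simp
  counit_act := by
    refine fun h b => LinearMap.congr_fun (LinearMap.congr_fun (f := ((trivialAct k).toLinearMap.compr₂ Coalgebra.counit)) (g := (LinearMap.mul k k).compl₁₂ Coalgebra.counit Coalgebra.counit) (lext k fun c => lext k fun a => ?_) h) b
    simp
  comul_coact := by
    refine lext k fun a => ?_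
    simp
  counit_coact := by
    refine fun b => LinearMap.congr_fun (f := (TensorProduct.rid k _).toLinearMap ∘ₗ (Coalgebra.counit (R := k) (A := GA k (C 3))).lTensor _ ∘ₗ sqCoact k) (g := LinearMap.smulRight Coalgebra.counit 1) (lext k fun a => ?_) b
    simp
    exact pPlus_add_pMinus k
  comul_one := by
    rw [MonoidAlgebra.one_def]
    simp
  counit_one := by
    rw [MonoidAlgebra.one_def]
    simp
  counit_mul := Bialgebra.counit_mul
  comul_mul := by
    refine TensorProduct.ext (lext k fun a => lext k fun b => ?_)
    simp
  antipode := HopfAlgebra.antipode k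
  antipode_act := by
    refine fun h b => LinearMap.congr_fun (LinearMap.congr_fun (f := ((trivialAct k).toLinearMap.compr₂ (HopfAlgebra.antipode k))) (g := (trivialAct k).toLinearMap.compl₂ (HopfAlgebra.antipode k)) (lext k fun c => lext k fun a => ?_) h) b
    simp
  antipode_coact := by
    refine lext k fun a => ?_
    simp
  antipode_left := by
    refine lext k fun a => ?_
    simp
  antipode_right := by
    refine lext k fun a => ?_
    simp

end YD

end

noncomputable section

namespace YD

/-! ### Characters of small algebras -/

section Characters

variable {k A : Type*} [Field k] [Ring A] [Algebra k A]

/-! The idempotents p₊, p₋ form the basis of k[C₂] dual to the characters ε and sgn. Hence a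
coaction is m ↦ p₊ ⊗ m + p₋ ⊗ γm, and a Yetter–Drinfeld module is a vector space with two commuting
involutions: σ (`actG`, the action of g) and γ (`grade`). The braiding is the flip as soon as σ or γ
is the identity. On a braided Hopf algebra both involutions respect the algebra and coalgebra
structures.

The main point is that in dimension 3 one of them is the identity (`trivial_of_finrank_eq_three`).
Otherwise diagonalise σ and γ simultaneously on ker ε. If no eigenvector of the basis is fixed by
both, homogeneity makes ker ε a square-zero ideal of primitive elements, which the braided
multiplicativity of Δ forbids (`false_of_no_invariants`). If one is, the other has both signs -1, so
B is a Hopf superalgebra with one even and one odd generator, and its structure constants satisfy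
incompatible equations (`false_of_super`).

So B is an ordinary Hopf algebra of dimension 3, and such a Hopf algebra is k[C₃]
(`nonempty_bialgEquiv`): it has a character χ ≠ ε, this χ has order 3 under convolution, and 1, χ,
χ² form a basis of the dual, so that a primitive cube root of unity yields a nontrivial group-like
element. Under the isomorphism σ and γ become Hopf automorphisms of k[C₃], each the identity or x ↦
x², and at least one is the identity: these are the three cases.

The biproducts are compared with their targets on group elements. For k^{S₃}, the six characters of
the commutative algebra k[C₃] ⊗ k[C₂] are indexed by the permutations τ through τ(0) and the sign of
τ. -/

theorem sq_finrank_le_of_isSimpleModule [IsAlgClosed k] [FiniteDimensional k A] (W : Type*)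
    [AddCommGroup W] [Module k W] [Module A W] [IsScalarTower k A W] [IsSimpleModule A W]
    [FiniteDimensional k W] : Module.finrank k W ^ 2 ≤ Module.finrank k A := by
  have hs : Function.Surjective (Algebra.lsmul k k W : A →ₐ[k] Module.End k W).toLinearMap := by
    intro f
    -- By Schur's lemma End_A(W) = k, so every k-linear `f` is linear over it and the density
    -- theorem applies; on a finite spanning set this gives `f` exactly.
    let F : Module.End (Module.End A W) W :=
      { toFun := f
        map_add' := map_add f
        map_smul' := fun φ w => by
          obtain ⟨t, rfl⟩ := (IsSimpleModule.algebraMap_end_bijective_of_isAlgClosed k).2 φ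
          simp }
    obtain ⟨s, hs⟩ := (Module.finite_def (R := k) (M := W)).1 inferInstance
    obtain ⟨a, ha⟩ := jacobson_density F s
    refine ⟨a, LinearMap.ext_on hs fun w hw => ?_⟩
    exact (ha w hw).symm
  have h := LinearMap.finrank_le_finrank_of_surjective hs
  rwa [Module.finrank_linearMap, ← pow_two] at h

theorem exists_algHom_of_line {z : A} (hz : z ≠ 0) (h : ∀ a : A, ∃ c : k, a * z = c • z) :
    ∃ χ : A →ₐ[k] k, ∀ a, a * z = χ a • z := by
  choose c hc using h
  have inj : ∀ {s t : k}, s • z = t • z → s = t := fun h => smul_left_injective k hz h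
  refine ⟨AlgHom.ofLinearMap
    { toFun := c
      map_add' := fun a b => inj (by rw [← hc, add_mul, hc, hc, add_smul])
      map_smul' := fun r a => inj (by rw [← hc, smul_mul_assoc, hc, smul_smul]; rfl) }
    (inj (by simp [← hc])) fun a b => inj ?_, hc⟩
  change c (a * b) • z = (c a * c b) • z
  rw [← hc, mul_assoc, hc b, mul_smul_comm, hc a, smul_smul, mul_comm]

/-- A simple submodule has dimension d with d² ≤ dim A < 4, so d = 1 and A acts on it through a
character. -/
theorem exists_line_in_left_ideal [IsAlgClosed k] [FiniteDimensional k A]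
    (hA : Module.finrank k A < 4) (I : Submodule A A) (hI : I ≠ ⊥) :
    ∃ z ∈ I, z ≠ 0 ∧ ∃ χ : A →ₐ[k] k, ∀ a, a * z = χ a • z := by
  have : IsArtinian A A := isArtinian_of_tower k inferInstance
  obtain ⟨W, hW, hWI⟩ := (eq_bot_or_exists_atom_le I).resolve_left hI
  have : IsSimpleModule A W := isSimpleModule_iff_isAtom.2 hW
  have : FiniteDimensional k W :=
    inferInstanceAs (FiniteDimensional k (W.restrictScalars k))
  have h := sq_finrank_le_of_isSimpleModule (k := k) (A := A) W
  have h1 : Module.finrank k W ≤ 1 := by nlinarith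
  obtain ⟨z, hz, hz0⟩ := (Submodule.ne_bot_iff W).1 hW.1
  refine ⟨z, hWI hz, hz0, exists_algHom_of_line hz0 fun a => ?_⟩
  obtain ⟨w, hw⟩ := finrank_le_one_iff.1 h1
  obtain ⟨c, hc⟩ := hw ⟨z, hz⟩
  obtain ⟨d, hd⟩ := hw ⟨a * z, W.smul_mem a hz⟩
  have hc0 : c ≠ 0 := by
    rintro rfl
    apply hz0
    simpa using (congrArg Subtype.val hc).symm
  refine ⟨d * c⁻¹, ?_⟩
  have hc' : c • (w : A) = z := congrArg Subtype.val hc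
  have hd' : d • (w : A) = a * z := congrArg Subtype.val hd
  rw [← hd', ← hc', smul_smul, inv_mul_cancel_right₀ hc0]

theorem exists_basis_of_functional {ε : A →ₗ[k] k} (h1 : ε 1 = 1)
    (hA : Module.finrank k A = 3) {u v : A} (hu : ε u = 0) (hv : ε v = 0) (hu0 : u ≠ 0)
    (hvu : v ∉ Submodule.span k {u}) :
    ∃ b : Module.Basis (Fin 3) k A, b 0 = 1 ∧ b 1 = u ∧ b 2 = v := by
  have hli : LinearIndependent k ![1, u, v] := by
    rw [Fintype.linearIndependent_iff]
    intro c hc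
    simp only [Fin.sum_univ_three, Matrix.cons_val] at hc
    have h0 : c 0 = 0 := by simpa [h1, hu, hv] using congrArg ε hc
    rw [h0, zero_smul, zero_add] at hc
    have h2 : c 2 = 0 := by
      by_contra h2
      refine hvu (Submodule.mem_span_singleton.2 ⟨-(c 2)⁻¹ * c 1, ?_⟩)
      rw [mul_smul, eq_neg_of_add_eq_zero_left hc, smul_neg, neg_smul, neg_neg, smul_smul,
        inv_mul_cancel₀ h2, one_smul]
    rw [h2, zero_smul, add_zero] at hc
    have h1 : c 1 = 0 := (smul_eq_zero.1 hc).resolve_right hu0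
    intro i
    fin_cases i <;> assumption
  exact ⟨basisOfLinearIndependentOfCardEqFinrank hli (by simp [hA]), by simp, by simp, by simp⟩

theorem exists_notMem_span_singleton {ε : A →ₗ[k] k} (hA : Module.finrank k A = 3) (u : A) :
    ∃ v, ε v = 0 ∧ v ∉ Submodule.span k {u} := by
  by_contra! h
  have : FiniteDimensional k A := FiniteDimensional.of_finrank_eq_succ hA
  have h1 : Module.finrank k ε.ker ≤ 1 :=
    (Submodule.finrank_mono (fun v hv => h v hv)).trans (finrank_span_le_card {u} |>.trans (by simp))
  have h2 := ε.finrank_range_add_finrank_ker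
  have h3 : Module.finrank k ε.range ≤ 1 := (Submodule.finrank_le _).trans (by simp)
  omega

end Characters

/-! ### Hopf algebras of dimension three -/

section ThreeDimensional

variable {k B : Type*} [Field k] [Ring B] [HopfAlgebra k B]

open WithConv Coalgebra

/-- The convolution inverse of χ is χ ∘ S. It is used only among linear maps, so S need not be known
to reverse products. -/
theorem conv_left_cancel {χ ψ φ : WithConv (B →ₐ[k] k)} (h : χ * ψ = χ * φ) : ψ = φ := by
  have hinv : toConv (χ.ofConv.toLinearMap ∘ₗ HopfAlgebra.antipode k) *
      toConv χ.ofConv.toLinearMap = 1 := by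
    have h1 := LinearMap.algHom_comp_convMul_distrib χ.ofConv
      (toConv (HopfAlgebra.antipode k (A := B))) (toConv LinearMap.id)
    rw [LinearMap.antipode_mul_id] at h1
    apply WithConv.ofConv_injective
    refine Eq.trans h1.symm ?_
    ext b
    simp [LinearMap.convOne_def]
  have h2 : toConv χ.ofConv.toLinearMap * toConv ψ.ofConv.toLinearMap =
      toConv χ.ofConv.toLinearMap * toConv φ.ofConv.toLinearMap := by
    rw [← AlgHom.toLinearMap_convMul, ← AlgHom.toLinearMap_convMul, h]
  have h3 := congrArg (toConv (χ.ofConv.toLinearMap ∘ₗ HopfAlgebra.antipode k) * ·) h2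
  simp only [← mul_assoc, hinv, one_mul] at h3
  exact WithConv.ofConv_injective
    (AlgHom.toLinearMap_injective (WithConv.toConv_injective h3))

/-- The algebra endomorphism `b ↦ b₁ χ(b₂)`. -/
def translate (χ : B →ₐ[k] k) : B →ₐ[k] B :=
  (Algebra.TensorProduct.rid k k B).toAlgHom.comp
    ((Algebra.TensorProduct.map (AlgHom.id k B) χ).comp (Bialgebra.comulAlgHom k B))

theorem apply_translate (χ ψ : WithConv (B →ₐ[k] k)) (b : B) :
    ψ.ofConv (translate χ.ofConv b) = (ψ * χ).ofConv b := by
  change _ = (ψ * χ) b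
  rw [AlgHom.convMul_apply]
  simp only [translate, AlgHom.comp_apply, Bialgebra.comulAlgHom_apply]
  induction comul (R := k) b with
  | zero => simp
  | tmul x y => simp [mul_comm]
  | add x y hx hy => simp only [map_add, hx, hy]

theorem translate_eq (χ : WithConv (B →ₐ[k] k)) : toConv (translate χ.ofConv).toLinearMap =
    toConv LinearMap.id * toConv (Algebra.linearMap k B ∘ₗ χ.ofConv.toLinearMap) := by
  apply WithConv.ofConv_injective
  ext b
  rw [LinearMap.convMul_def]
  simp only [translate, AlgHom.toLinearMap_apply, AlgHom.comp_apply, Bialgebra.comulAlgHom_apply,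
    LinearMap.comp_apply]
  induction comul (R := k) b with
  | zero => simp
  | tmul x y => simp [Algebra.smul_def, Algebra.commutes]
  | add x y hx hy => simp only [map_add, hx, hy]

theorem translate_translate {χ ψ : WithConv (B →ₐ[k] k)} (h : χ * ψ = 1) (b : B) :
    translate χ.ofConv (translate ψ.ofConv b) = b := by
  have h1 := LinearMap.algHom_comp_convMul_distrib (translate χ.ofConv) (toConv LinearMap.id)
    (toConv (Algebra.linearMap k B ∘ₗ ψ.ofConv.toLinearMap))
  rw [← translate_eq] at h1
  have h2 : (translate χ.ofConv).toLinearMap ∘ₗ (Algebra.linearMap k B ∘ₗ ψ.ofConv.toLinearMap) =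
      Algebra.linearMap k B ∘ₗ ψ.ofConv.toLinearMap := by
    ext; simp
  have h3 := LinearMap.algHom_comp_convMul_distrib (Algebra.ofId k B)
    (toConv χ.ofConv.toLinearMap) (toConv ψ.ofConv.toLinearMap)
  rw [← AlgHom.toLinearMap_convMul, h, AlgHom.toLinearMap_convOne] at h3
  simp only [LinearMap.comp_id, h2] at h1
  rw [translate_eq, mul_assoc] at h1
  have h4 : toConv (Algebra.linearMap k B ∘ₗ χ.ofConv.toLinearMap) *
      toConv (Algebra.linearMap k B ∘ₗ ψ.ofConv.toLinearMap) = 1 := by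
    apply WithConv.ofConv_injective
    refine Eq.trans h3.symm ?_
    ext b
    simp [Algebra.ofId_apply, LinearMap.convOne_def]
  rw [h4, mul_one] at h1
  exact LinearMap.congr_fun h1 b

/-- If χ had order 2, the common kernel of ε and χ would be an ideal of dimension 1, on which B acts
by a character ψ. Translation by χ preserves this line, which forces ψχ = ψ and hence χ = 1. -/
theorem conv_mul_self_ne_one (hB : Module.finrank k B = 3) {χ : WithConv (B →ₐ[k] k)}
    (hχ : χ ≠ 1) : χ * χ ≠ 1 := by
  intro hχχ
  have : FiniteDimensional k B := FiniteDimensional.of_finrank_eq_succ hB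
  let ε : B →ₐ[k] k := (1 : WithConv (B →ₐ[k] k)).ofConv
  obtain ⟨b, hb⟩ : ∃ b, ε b ≠ χ.ofConv b := by
    by_contra! h
    exact hχ (WithConv.ofConv_injective (AlgHom.ext fun b => (h b).symm))
  let φ : B →ₗ[k] k × k := ε.toLinearMap.prod χ.ofConv.toLinearMap
  have hφ : ∀ y, y ∈ φ.ker ↔ ε y = 0 ∧ χ.ofConv y = 0 := fun y => by
    simp [φ, LinearMap.ker_prod]
  have hsurj : φ.range = ⊤ := by
    rw [LinearMap.range_eq_top]
    rintro ⟨s, t⟩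
    have hd : ε b - χ.ofConv b ≠ 0 := sub_ne_zero.2 hb
    refine ⟨((s - t) / (ε b - χ.ofConv b)) • b +
      ((t * ε b - s * χ.ofConv b) / (ε b - χ.ofConv b)) • 1, ?_⟩
    have hφa : ∀ y, φ y = (ε y, χ.ofConv y) := fun y => rfl
    rw [hφa]
    simp only [map_add, map_smul, map_one, smul_eq_mul, Prod.mk.injEq]
    constructor <;> field_simp <;> ring
  have hker : Module.finrank k φ.ker = 1 := by
    have := φ.finrank_range_add_finrank_ker
    rw [hsurj, finrank_top, hB, Module.finrank_prod, Module.finrank_self] at this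
    omega
  obtain ⟨⟨z, hz⟩, hz0, hline⟩ := finrank_eq_one_iff'.1 hker
  have hz0 : z ≠ 0 := fun h => hz0 (Subtype.ext h)
  have hline : ∀ y, ε y = 0 → χ.ofConv y = 0 → ∃ c : k, y = c • z := fun y h1 h2 => by
    obtain ⟨c, hc⟩ := hline ⟨y, (hφ y).2 ⟨h1, h2⟩⟩
    exact ⟨c, (congrArg Subtype.val hc).symm⟩
  obtain ⟨hz1, hz2⟩ := (hφ z).1 hz
  obtain ⟨ψ, hψ⟩ := exists_algHom_of_line (k := k) hz0 fun a =>
    hline (a * z) (by rw [map_mul, hz1, mul_zero]) (by rw [map_mul, hz2, mul_zero])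
  -- Precomposition with translation by χ exchanges ε and χ, since χχ = 1; their common kernel is
  -- therefore stable.
  obtain ⟨c, hc⟩ := hline (translate χ.ofConv z)
    (by rw [apply_translate, one_mul, hz2]) (by rw [apply_translate, hχχ]; exact hz1)
  have hc0 : c ≠ 0 := by
    rintro rfl
    rw [zero_smul] at hc
    apply hz0
    rw [← translate_translate hχχ z, hc, map_zero]
  -- Translating az = ψ(a)z and comparing with the action on the multiple cz shows that ψ is
  -- unchanged by the translation.
  have key : toConv ψ * χ = toConv ψ * 1 := by
    rw [mul_one]
    refine WithConv.ofConv_injective (AlgHom.ext fun a => ?_)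
    rw [← apply_translate]
    have h1 := congrArg (translate χ.ofConv) (hψ a)
    rw [map_mul, map_smul, hc, mul_smul_comm, hψ] at h1
    simp only [smul_smul] at h1
    have h2 := smul_left_injective k hz0 h1
    rw [mul_comm] at h2
    exact mul_right_cancel₀ hc0 h2
  exact hχ (conv_left_cancel key)

/-- Otherwise 1, χ, χ², χ³ would be four distinct characters, hence four independent functionals on
a space of dimension 3. -/
theorem conv_pow_three_eq_one (hB : Module.finrank k B = 3) {χ : WithConv (B →ₐ[k] k)}
    (hχ : χ ≠ 1) : χ ^ 3 = 1 := by
  by_contra h3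
  have : FiniteDimensional k B := FiniteDimensional.of_finrank_eq_succ hB
  have h2 : χ ^ 2 ≠ 1 := by rw [pow_two]; exact conv_mul_self_ne_one hB hχ
  have hlt : ∀ i j : Fin 4, i < j → χ ^ (i : ℕ) ≠ χ ^ (j : ℕ) := by
    intro i j hij h
    have h' : χ ^ ((j : ℕ) - i) = 1 := by
      refine conv_left_cancel (χ := χ ^ (i : ℕ)) ?_
      rw [← pow_add, mul_one, h]
      congr 1
      omega
    have : (j : ℕ) - i = 1 ∨ (j : ℕ) - i = 2 ∨ (j : ℕ) - i = 3 := by omega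
    rcases this with h1 | h1 | h1 <;> rw [h1] at h'
    · exact hχ (by simpa using h')
    · exact h2 h'
    · exact h3 h'
  have hinj : Function.Injective fun i : Fin 4 => (χ ^ (i : ℕ)).ofConv := by
    intro i j h
    have h := WithConv.ofConv_injective h
    rcases lt_trichotomy i j with hij | hij | hij
    · exact (hlt i j hij h).elim
    · exact hij
    · exact (hlt j i hij h.symm).elim
  have hli := ((linearIndependent_algHom_toLinearMap k B k).comp _ hinj).fintype_card_le_finrank
  rw [Module.finrank_linearMap, hB, Module.finrank_self] at hli
  simp at hli

end ThreeDimensional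

/-! ### Existence of a nontrivial character, and the identification with k[C₃]. -/

section ThreeDimensional

variable {k B : Type*} [Field k] [Ring B] [HopfAlgebra k B]

open WithConv Coalgebra

/-- The linear endomorphism `b ↦ b₁ f(b₂)`. -/
def contractRight (f : B →ₗ[k] k) : B →ₗ[k] B :=
  (TensorProduct.rid k B).toLinearMap ∘ₗ f.lTensor B ∘ₗ comul

theorem counit_contractRight (f : B →ₗ[k] k) (b : B) : counit (R := k) (contractRight f b) = f b := by
  have h : ∀ t : B ⊗[k] B, counit (R := k) (TensorProduct.rid k B (f.lTensor B t)) =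
      f (TensorProduct.lid k B ((counit (R := k)).rTensor B t)) := fun t => by
    induction t with
    | zero => simp
    | tmul x y => simp [mul_comm]
    | add x y hx hy => simp only [map_add, hx, hy]
  change counit (R := k) (TensorProduct.rid k B (f.lTensor B (comul b))) = _
  rw [h, Coalgebra.rTensor_counit_comul]
  simp

/-- An ε-derivation extends to a derivation of B; by `counit_contractRight` it is recovered by
applying ε. -/
theorem contractRight_mul {f : B →ₗ[k] k}
    (hf : ∀ a b, f (a * b) = counit (R := k) a * f b + f a * counit (R := k) b) (a b : B) :
    contractRight f (a * b) = a * contractRight f b + contractRight f a * b := by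
  have h : ∀ s t : B ⊗[k] B, TensorProduct.rid k B (f.lTensor B (s * t)) =
      TensorProduct.rid k B ((counit (R := k)).lTensor B s) *
        TensorProduct.rid k B (f.lTensor B t) +
      TensorProduct.rid k B (f.lTensor B s) *
        TensorProduct.rid k B ((counit (R := k)).lTensor B t) := fun s t => by
    induction s with
    | zero => simp
    | add x y hx hy => rw [add_mul, map_add, map_add, hx, hy]; simp only [map_add, add_mul]; abel
    | tmul x y =>
      induction t with
      | zero => simp
      | add x y hx hy => rw [mul_add, map_add, map_add, hx, hy]; simp only [map_add, mul_add]; abel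
      | tmul x' y' =>
        simp only [Algebra.TensorProduct.tmul_mul_tmul, LinearMap.lTensor_tmul,
          TensorProduct.rid_tmul, hf, add_smul, smul_mul_smul_comm]
  change TensorProduct.rid k B (f.lTensor B (comul (a * b))) = a * TensorProduct.rid k B
    (f.lTensor B (comul b)) + TensorProduct.rid k B (f.lTensor B (comul a)) * b
  rw [Bialgebra.comul_mul, h, Coalgebra.lTensor_counit_comul, Coalgebra.lTensor_counit_comul]
  simp

/-- If ε is the only character, ker ε has a basis z, v with az = ε(a)z and B acts on ker ε / kz by ε
as well. Then the coordinate f of v is an ε-derivation, with associated derivation D. Evaluating D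
on vz = 0 and on v² = μz gives the values -1 and 2 for the same scalar, so 3 = 0. -/
theorem exists_conv_ne_one [IsAlgClosed k] [CharZero k] (hB : Module.finrank k B = 3) :
    ∃ χ : WithConv (B →ₐ[k] k), χ ≠ 1 := by
  by_contra! hall
  have : FiniteDimensional k B := FiniteDimensional.of_finrank_eq_succ hB
  have hall : ∀ (χ : B →ₐ[k] k) (a : B), χ a = counit (R := k) a := fun χ a =>
    congrArg (fun ψ : WithConv (B →ₐ[k] k) => ψ.ofConv a) (hall (toConv χ))
  have hV : RingHom.ker (Bialgebra.counitAlgHom k B) ≠ ⊥ := by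
    obtain ⟨v, hv, hv0⟩ := exists_notMem_span_singleton (ε := counit (R := k) (A := B)) hB 0
    refine (Submodule.ne_bot_iff _).2 ⟨v, hv, ?_⟩
    rintro rfl
    exact hv0 (Submodule.zero_mem _)
  obtain ⟨z, hz, hz0, ψ, hψ⟩ := exists_line_in_left_ideal (k := k) (by omega) _ hV
  have hz : counit (R := k) z = 0 := hz
  simp only [hall] at hψ
  obtain ⟨v, hv, hvz⟩ := exists_notMem_span_singleton (ε := counit (R := k) (A := B)) hB z
  obtain ⟨β, hβ0, hβ1, hβ2⟩ := exists_basis_of_functional (Bialgebra.counit_one) hB hz hv hz0 hvz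
  let f : B →ₗ[k] k := β.coord 2
  have f1 : f 1 = 0 := by simp [f, ← hβ0]
  have fz : f z = 0 := by simp [f, ← hβ1]
  have fv : f v = 1 := by simp [f, ← hβ2]
  have hspan : ∀ y, counit (R := k) y = 0 → ∃ q : k, y = f y • v + q • z := fun y hy => by
    have h := β.sum_repr y
    rw [Fin.sum_univ_three, hβ0, hβ1, hβ2] at h
    have h' := congrArg (counit (R := k)) h
    simp only [map_add, map_smul, hz, hv, Bialgebra.counit_one, smul_eq_mul, mul_zero, add_zero,
      mul_one, hy] at h'
    rw [h', zero_smul, zero_add, add_comm] at h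
    exact ⟨_, h.symm⟩
  have hfm : ∀ a y, counit (R := k) y = 0 → f (a * y) = f (a * v) * f y := fun a y hy => by
    obtain ⟨q, hq⟩ := hspan y hy
    conv_lhs => rw [hq]
    rw [mul_add, mul_smul_comm, mul_smul_comm, hψ, map_add, map_smul, map_smul, map_smul, fz]
    simp [mul_comm]
  -- By `hfm`, a ↦ f(av) is multiplicative: it is the character by which B acts on ker ε / kz.
  have hfv : ∀ a, f (a * v) = counit (R := k) a :=
    hall (AlgHom.ofLinearMap (f ∘ₗ LinearMap.mulRight k v) (by simp [fv]) fun a b => by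
      simp only [LinearMap.comp_apply, LinearMap.mulRight_apply]
      rw [mul_assoc, hfm]
      rw [Bialgebra.counit_mul, hv, mul_zero])
  have hf : ∀ a b, f (a * b) = counit (R := k) a * f b + f a * counit (R := k) b := fun a b => by
    have h := hfm a (b - counit (R := k) b • 1) (by simp)
    rw [hfv, mul_sub, mul_smul_comm, mul_one, map_sub, map_sub, map_smul, map_smul, f1] at h
    simp only [smul_eq_mul, mul_zero, sub_zero] at h
    linear_combination h
  have hD := contractRight_mul hf
  have hεD := counit_contractRight f
  obtain ⟨μ, hμ⟩ := hspan (v * v) (by rw [Bialgebra.counit_mul, hv, mul_zero])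
  rw [hfv, hv, zero_smul, zero_add] at hμ
  obtain ⟨q, hq⟩ := hspan (contractRight f z) (by rw [hεD, fz])
  -- As vz = 0 and f(v) = 1, this reads 0 = (f(Dz)μ + 1)z.
  have h1 := hD v z
  rw [hψ, hv, zero_smul, map_zero, hψ, hεD, fv, one_smul, hq, mul_add, mul_smul_comm,
    mul_smul_comm, hμ, hψ, hv, zero_smul, smul_zero, add_zero, smul_smul] at h1
  have h2 : f (contractRight f z) * μ = -1 := by
    apply smul_left_injective k hz0
    simp only [neg_smul, one_smul]
    exact (neg_eq_of_add_eq_zero_left h1.symm).symm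
  -- Here f(v Dv + Dv v) = 1 + 1, because ε(Dv) = f(v) = 1 and ε(v) = 0.
  have h3 := congrArg f (hD v v)
  rw [hμ, map_smul, map_smul, map_add, hf, hf, hv, hεD, fv, smul_eq_mul] at h3
  have h4 : (3 : k) = 0 := by linear_combination h2 - h3
  norm_num at h4

/-- The homomorphism from the cyclic group of order three given by an element with cube one. -/
def powHom {M : Type*} [Monoid M] {x : M} (hx : x ^ 3 = 1) : C 3 →* M where
  toFun a := x ^ (Multiplicative.toAdd a).val
  map_one' := by simp
  map_mul' a b := by
    rw [toAdd_mul, ZMod.val_add, ← pow_add, ← pow_eq_pow_mod _ hx]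

theorem pi_injective_of_linearIndependent {k M ι : Type*} [Field k] [AddCommGroup M] [Module k M]
    [FiniteDimensional k M] [Fintype ι] {ψ : ι → Module.Dual k M} (hψ : LinearIndependent k ψ)
    (hM : Fintype.card ι = Module.finrank k M) : Function.Injective (LinearMap.pi ψ) := by
  have hspan := hψ.span_eq_top_of_card_eq_finrank' (by rw [Subspace.dual_finrank_eq, hM])
  rw [← LinearMap.ker_eq_bot, LinearMap.ker_eq_bot']
  intro b hb
  rw [← Module.forall_dual_apply_eq_zero_iff k]
  intro φ
  have hφ : φ ∈ Submodule.span k (Set.range ψ) := hspan ▸ Submodule.mem_top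
  induction hφ using Submodule.span_induction with
  | mem φ hφ => obtain ⟨i, rfl⟩ := hφ; exact congrFun hb i
  | zero => simp
  | add _ _ _ _ h1 h2 => simp [h1, h2]
  | smul _ _ _ h => simp [h]

/-- The characters 1, χ, χ² are coordinates identifying B with k³. The element with coordinates 1,
ω, ω² is group-like, because (χ^i ⊗ χ^j)(Δx) = χ^(i+j)(x) = ω^(i+j). -/
theorem exists_isGroupLikeElem [IsAlgClosed k] [CharZero k] (hB : Module.finrank k B = 3) :
    ∃ x : B, IsGroupLikeElem k x ∧ x ^ 3 = 1 ∧ x ≠ 1 := by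
  have : FiniteDimensional k B := FiniteDimensional.of_finrank_eq_succ hB
  obtain ⟨χ, hχ⟩ := exists_conv_ne_one hB
  have h2 : χ ^ 2 ≠ 1 := by rw [pow_two]; exact conv_mul_self_ne_one hB hχ
  have h3 := conv_pow_three_eq_one hB hχ
  have hinj : Function.Injective fun i : Fin 3 => (χ ^ (i : ℕ)).ofConv := by
    intro i j h
    have h := WithConv.ofConv_injective h
    have h21 : χ ^ 2 ≠ χ := fun h => hχ (conv_left_cancel (χ := χ) (by rw [← pow_two, h, mul_one]))
    fin_cases i <;> fin_cases j <;> simp [hχ, h2, h21, hχ.symm, h2.symm, h21.symm] at h ⊢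
  let ψ : Fin 3 → Module.Dual k B := fun i => (χ ^ (i : ℕ)).ofConv.toLinearMap
  have hli : LinearIndependent k ψ := (linearIndependent_algHom_toLinearMap k B k).comp _ hinj
  have hinj' := pi_injective_of_linearIndependent hli (by simp [hB])
  let e := LinearEquiv.ofInjectiveOfFinrankEq (LinearMap.pi ψ) hinj' (by simp [hB])
  have he : ∀ b i, e b i = (χ ^ (i : ℕ)).ofConv b := fun b i => rfl
  let β := Module.Basis.ofEquivFun e
  have hβ : ∀ b i, β.repr b i = (χ ^ (i : ℕ)).ofConv b := fun b i => rfl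
  obtain ⟨ω, hω⟩ : ∃ ω : k, IsPrimitiveRoot ω 3 := HasEnoughRootsOfUnity.exists_primitiveRoot k 3
  let x := e.symm fun i => ω ^ (i : ℕ)
  have hx' : ∀ i : Fin 3, (χ ^ (i : ℕ)).ofConv x = ω ^ (i : ℕ) := fun i => by
    rw [← he, e.apply_symm_apply]
  have hx : ∀ n : ℕ, (χ ^ n).ofConv x = ω ^ n := fun n => by
    rw [pow_eq_pow_mod n h3, pow_eq_pow_mod n hω.pow_eq_one]
    exact hx' ⟨n % 3, Nat.mod_lt _ (by norm_num)⟩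
  refine ⟨x, ⟨?_, ?_⟩, ?_, ?_⟩
  · simpa using hx 0
  · refine (β.tensorProduct β).ext_elem fun ⟨i, j⟩ => ?_
    have h : ∀ t : B ⊗[k] B, (β.tensorProduct β).repr t (i, j) = Algebra.TensorProduct.lift
        (χ ^ (i : ℕ)).ofConv (χ ^ (j : ℕ)).ofConv (fun _ _ => .all ..) t := fun t => by
      induction t with
      | zero => simp
      | tmul b c => simp [Module.Basis.tensorProduct_repr_tmul_apply, hβ, mul_comm]
      | add s t hs ht => simp only [map_add, Finsupp.add_apply, hs, ht]
    rw [h, h, ← AlgHom.convMul_apply, ← pow_add]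
    refine (hx _).trans ?_
    simp [hx, pow_add]
  · refine e.injective (funext fun i => ?_)
    rw [he, he, map_pow, map_one, hx, ← pow_mul, mul_comm, pow_mul, hω.pow_eq_one, one_pow]
  · intro h
    have := hx 1
    rw [h, map_one, pow_one] at this
    exact hω.ne_one (by norm_num) this.symm

theorem nonempty_bialgEquiv [IsAlgClosed k] [CharZero k] (hB : Module.finrank k B = 3) :
    Nonempty (B ≃ₐc[k] MonoidAlgebra k (C 3)) := by
  have : FiniteDimensional k B := FiniteDimensional.of_finrank_eq_succ hB
  obtain ⟨x, hg, h3, h1⟩ := exists_isGroupLikeElem (k := k) hB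
  let φ := MonoidAlgebra.lift k B (C 3) (powHom h3)
  have hφ : ∀ a, φ (MonoidAlgebra.single a 1) = x ^ (Multiplicative.toAdd a).val := fun a => by
    simp [φ, powHom]
  have hgl : ∀ n, IsGroupLikeElem k (x ^ n) := fun n => hg.pow
  let Φ : MonoidAlgebra k (C 3) →ₐc[k] B := BialgHom.ofAlgHom φ
    (MonoidAlgebra.algHom_ext (fun a => by simp [hφ, (hgl _).counit_eq_one]) (by ext))
    (MonoidAlgebra.algHom_ext (fun a => by simp [hφ, (hgl _).comul_eq_tmul_self]) (by ext))
  have h21 : x ^ 2 ≠ 1 := fun h => h1 (by rw [← h3, pow_succ, h, one_mul])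
  have h22 : x ^ 2 ≠ x := fun h => h21 (by rw [← h3, pow_succ x 2, h, ← pow_two, h])
  have hinj : Function.Injective fun a : C 3 =>
      (⟨x ^ (Multiplicative.toAdd a).val, hgl _⟩ : GroupLike k B) := by
    intro a b h
    have h := congrArg GroupLike.val h
    have h : x ^ (Multiplicative.toAdd a).val = x ^ (Multiplicative.toAdd b).val := h
    apply Multiplicative.toAdd.injective
    generalize Multiplicative.toAdd a = a at h ⊢
    generalize Multiplicative.toAdd b = b at h ⊢
    fin_cases a <;> fin_cases b <;>
      first | rfl | simp [ZMod.val, h1, h21, h22, h1.symm, h21.symm, h22.symm] at h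
  have hΦ : Function.Injective φ.toLinearMap :=
    LinearMap.injective_of_linearIndependent (v := fun a : C 3 => MonoidAlgebra.single a 1)
      (by
        exact (MonoidAlgebra.basis (C 3) k).span_eq) (by
        have := (linearIndep_groupLikeVal (R := k) (A := B)).comp _ hinj
        rwa [show φ.toLinearMap ∘ _ = _ from funext hφ])
  have hfr : Module.finrank k (MonoidAlgebra k (C 3)) = Module.finrank k B := by
    rw [hB, Module.finrank_eq_card_basis (MonoidAlgebra.basis (C 3) k)]
    rfl
  exact ⟨(BialgEquiv.ofBijective Φ ⟨hΦ,
    (LinearMap.injective_iff_surjective_of_finrank_eq_finrank hfr).1 hΦ⟩).symm⟩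

end ThreeDimensional

/-! ### Yetter-Drinfeld modules over `k[C₂]` as spaces with two commuting involutions -/

section Involutions

variable (k : Type*) [Field k]

/-- The sign character of `k[C₂]`. -/
def sgn : GA k (C 2) →ₐ[k] k :=
  MonoidAlgebra.lift k k (C 2)
    { toFun := fun c => if c = 1 then 1 else -1
      map_one' := by simp
      map_mul' := by
        have h : ∀ a b : C 2, a ≠ 1 → b ≠ 1 → a * b = 1 := by decide
        intro a b
        by_cases ha : a = 1
        · simp [ha]
        · by_cases hb : b = 1
          · simp [hb]
          · simp [ha, hb, h a b ha hb] }

theorem sgn_g : sgn k (MonoidAlgebra.single g 1) = -1 := by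
  simp [sgn, show g ≠ 1 by decide]

theorem sgn_pPlus : sgn k (pPlus k) = 0 := by
  rw [pPlus, map_smul, map_add, map_one, MonoidAlgebra.of_apply, sgn_g]
  simp

theorem sgn_pMinus [CharZero k] : sgn k (pMinus k) = 1 := by
  rw [pMinus, map_smul, map_sub, map_one, MonoidAlgebra.of_apply, sgn_g]
  norm_num

theorem eq_one_or_eq_g (c : C 2) : c = 1 ∨ c = g := by
  revert c; decide

variable {k}
variable {M : Type*} [AddCommGroup M] [Module k M]

/-- The contraction `h ⊗ m ↦ sgn(h) m`. -/
def sgnContract : GA k (C 2) ⊗[k] M →ₗ[k] M :=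
  (TensorProduct.lid k M).toLinearMap ∘ₗ (sgn k).toLinearMap.rTensor M

theorem sgnContract_tmul (h : GA k (C 2)) (m : M) : sgnContract (h ⊗ₜ[k] m) = sgn k h • m := by
  simp [sgnContract]

/-- The coordinates of k[C₂] with respect to p₊, p₋ are its two characters; applied to coactions
this yields the involution `grade`. -/
theorem eq_smul_pPlus_add_smul_pMinus [CharZero k] (h : GA k (C 2)) :
    h = Coalgebra.counit (R := k) h • pPlus k + sgn k h • pMinus k := by
  have hl : LinearMap.id = LinearMap.smulRight (Coalgebra.counit (R := k)) (pPlus k) +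
      LinearMap.smulRight (sgn k).toLinearMap (pMinus k) := by
    refine lext k fun c => ?_
    simp only [LinearMap.id_apply, LinearMap.add_apply, LinearMap.smulRight_apply,
      AlgHom.toLinearMap_apply]
    rcases eq_one_or_eq_g c with rfl | rfl
    · rw [← MonoidAlgebra.one_def, map_one (sgn k), Bialgebra.counit_one, one_smul, one_smul,
        pPlus_add_pMinus]
    · rw [sgn_g, MonoidAlgebra.counit_single, pPlus, pMinus, MonoidAlgebra.of_apply]
      simp only [CommSemiring.counit_apply, one_smul, neg_smul]
      rw [← sub_eq_add_neg, ← smul_sub, add_sub_sub_cancel, ← two_smul k, smul_smul]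
      norm_num
  exact LinearMap.congr_fun hl h

theorem eq_pPlus_tmul_add_pMinus_tmul [CharZero k] (t : GA k (C 2) ⊗[k] M) :
    t = pPlus k ⊗ₜ (TensorProduct.lid k M ((Coalgebra.counit (R := k)).rTensor M t)) +
      pMinus k ⊗ₜ sgnContract t := by
  induction t with
  | zero => simp
  | tmul h m =>
    conv_lhs => rw [eq_smul_pPlus_add_smul_pMinus h, add_tmul, smul_tmul, smul_tmul]
    rw [LinearMap.rTensor_tmul, TensorProduct.lid_tmul, sgnContract_tmul]
  | add s t hs ht =>
    conv_lhs => rw [hs, ht]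
    simp only [map_add, tmul_add]
    abel

namespace YDModule

variable (V : YDModule k (GA k (C 2)) M)

/-- The action of the generator of `C₂`. -/
def actG : M →ₗ[k] M := V.act (MonoidAlgebra.single g 1)

/-- The grading involution given by a coaction of `k[C₂]`. -/
def grade : M →ₗ[k] M := sgnContract ∘ₗ V.coact

theorem coact_eq [CharZero k] (m : M) :
    V.coact m = pPlus k ⊗ₜ m + pMinus k ⊗ₜ V.grade m := by
  rw [eq_pPlus_tmul_add_pMinus_tmul (V.coact m)]
  congr 2
  exact LinearMap.congr_fun V.coact_counit m

theorem actG_actG (m : M) : V.actG (V.actG m) = m := by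
  have h := g_mul_g k
  rw [MonoidAlgebra.of_apply] at h
  change (V.act (MonoidAlgebra.single g 1) * V.act (MonoidAlgebra.single g 1)) m = m
  rw [← map_mul, h, map_one, Module.End.one_apply]

theorem act_single (c : C 2) (m : M) :
    V.act (MonoidAlgebra.single c 1) m = if c = 1 then m else V.actG m := by
  rcases eq_one_or_eq_g c with rfl | rfl
  · rw [← MonoidAlgebra.one_def, map_one, if_pos rfl, Module.End.one_apply]
  · rw [if_neg (by decide)]
    rfl

theorem grade_grade [CharZero k] (m : M) : V.grade (V.grade m) = m := by
  have h := LinearMap.congr_fun V.coact_coassoc m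
  simp only [LinearMap.comp_apply, V.coact_eq, map_add, LinearMap.rTensor_tmul,
    LinearMap.lTensor_tmul, comul_pPlus, comul_pMinus, add_tmul, LinearEquiv.coe_coe,
    TensorProduct.assoc_tmul] at h
  -- Two contractions extract the p₋ ⊗ p₋ component of coassociativity; p₋ ⊗ p₋ occurs in Δ(p₊) and
  -- not in Δ(p₋).
  have h' := congrArg sgnContract (congrArg sgnContract h)
  simpa [sgnContract_tmul, sgn_pPlus, sgn_pMinus] using h'.symm

theorem actG_grade [CharZero k] (m : M) : V.actG (V.grade m) = V.grade (V.actG m) := by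
  have h := LinearMap.congr_fun V.compat (MonoidAlgebra.single g 1 ⊗ₜ m)
  have h' := congrArg sgnContract h
  have e : ∀ x, V.act (MonoidAlgebra.single g 1) x = V.actG x := fun x => rfl
  simp only [LinearMap.comp_apply, TensorProduct.map_tmul, LinearMap.rTensor_tmul,
    MonoidAlgebra.comul_single, CommSemiring.comul_apply, MonoidAlgebra.lsingle_apply,
    LinearEquiv.coe_coe, TensorProduct.rightComm_tmul, V.coact_eq, tmul_add, add_tmul, map_add,
    TensorProduct.tensorTensorTensorComm_tmul, actMap, TensorProduct.lift.tmul,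
    AlgHom.toLinearMap_apply, e, LinearMap.mul'_apply, sgnContract_tmul, map_mul, sgn_g, sgn_pPlus,
    sgn_pMinus] at h'
  simpa using h'

theorem braiding_tmul [CharZero k] {N : Type*} [AddCommGroup N] [Module k N]
    (W : YDModule k (GA k (C 2)) N) (m : M) (n : N) :
    V.braiding W (m ⊗ₜ n) = (2⁻¹ : k) • ((n + W.actG n) ⊗ₜ m + (n - W.actG n) ⊗ₜ V.grade m) := by
  have e : ∀ x, W.act (MonoidAlgebra.single g 1) x = W.actG x := fun x => rfl
  simp only [braiding, crossMap, LinearMap.comp_apply, LinearMap.rTensor_tmul, V.coact_eq, add_tmul,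
    map_add, LinearEquiv.coe_coe, TensorProduct.rightComm_tmul, actMap, TensorProduct.lift.tmul,
    AlgHom.toLinearMap_apply, pPlus, pMinus, map_smul, map_sub, MonoidAlgebra.of_apply, map_one,
    LinearMap.sub_apply, e, Module.End.one_apply,
    ← smul_tmul', smul_add]

theorem tensorCoact_apply [CharZero k] {N : Type*} [AddCommGroup N] [Module k N]
    (W : YDModule k (GA k (C 2)) N) (t : M ⊗[k] N) :
    V.tensorCoact W t = pPlus k ⊗ₜ t + pMinus k ⊗ₜ TensorProduct.map V.grade W.grade t := by
  induction t with
  | zero => simp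
  | tmul m n => simp [tensorCoact, V.coact_eq, W.coact_eq, tmul_add, add_tmul, pPlus_mul_pPlus,
      pMinus_mul_pMinus, pPlus_mul_pMinus, pMinus_mul_pPlus]
  | add s t hs ht => simp only [map_add, hs, ht, tmul_add]; abel

theorem tensorAct_g_tmul {N : Type*} [AddCommGroup N] [Module k N]
    (W : YDModule k (GA k (C 2)) N) (t : M ⊗[k] N) :
    V.tensorAct W (MonoidAlgebra.single g 1 ⊗ₜ t) = TensorProduct.map V.actG W.actG t := by
  induction t with
  | zero => simp
  | tmul m n => simp [tensorAct, actMap, actG]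
  | add s t hs ht => simp only [map_add, hs, ht, tmul_add]

end YDModule

namespace BraidedHopfAlgebra

open Coalgebra

variable {B : Type*} [Ring B] [Algebra k B] [Coalgebra k B]
  (S : BraidedHopfAlgebra k (GA k (C 2)) B)

theorem actG_mul (a b : B) : S.actG (a * b) = S.actG a * S.actG b := by
  have h := LinearMap.congr_fun S.act_mul (MonoidAlgebra.single g 1 ⊗ₜ (a ⊗ₜ b))
  rw [LinearMap.comp_apply, YDModule.tensorAct_g_tmul] at h
  rw [YDModule.actG]
  simpa [actMap, YDModule.actG] using h.symm

theorem actG_one : S.actG 1 = 1 := by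
  rw [YDModule.actG]
  simpa using S.act_one (MonoidAlgebra.single g 1)

theorem comul_actG (b : B) :
    comul (R := k) (S.actG b) = TensorProduct.map S.actG S.actG (comul b) := by
  have h := LinearMap.congr_fun S.comul_act (MonoidAlgebra.single g 1 ⊗ₜ b)
  rw [LinearMap.comp_apply, LinearMap.comp_apply, LinearMap.lTensor_tmul,
    YDModule.tensorAct_g_tmul] at h
  exact h

theorem counit_actG (b : B) : counit (R := k) (S.actG b) = counit (R := k) b := by
  rw [YDModule.actG]
  simpa using S.counit_act (MonoidAlgebra.single g 1) b

theorem grade_one : S.grade 1 = 1 := by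
  have h := congrArg sgnContract S.coact_one
  rw [YDModule.grade]
  simpa [sgnContract_tmul] using h

variable [CharZero k]

theorem grade_mul (a b : B) : S.grade (a * b) = S.grade a * S.grade b := by
  have h := LinearMap.congr_fun S.coact_mul (a ⊗ₜ b)
  rw [LinearMap.comp_apply, LinearMap.comp_apply, YDModule.tensorCoact_apply] at h
  have h' := congrArg sgnContract h
  simpa [sgnContract_tmul, sgn_pPlus, sgn_pMinus, YDModule.coact_eq] using h'

theorem comul_grade (b : B) :
    comul (R := k) (S.grade b) = TensorProduct.map S.grade S.grade (comul b) := by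
  have h := LinearMap.congr_fun S.comul_coact b
  rw [LinearMap.comp_apply, LinearMap.comp_apply, YDModule.tensorCoact_apply] at h
  have h' := congrArg sgnContract h
  simpa [sgnContract_tmul, sgn_pPlus, sgn_pMinus, YDModule.coact_eq] using h'

theorem counit_grade (b : B) : counit (R := k) (S.grade b) = counit (R := k) b := by
  have h := congrArg (sgn k) (S.counit_coact b)
  simpa [sgn_pPlus, sgn_pMinus, YDModule.coact_eq] using h

end BraidedHopfAlgebra

end Involutions

/-! ### Braided Hopf algebras of dimension three with trivial braiding -/

section TrivialBraiding

open WithConv Coalgebra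

/-- Both f ∘ S and S ∘ f are convolution inverses of f, one on the left and one on the right. -/
theorem bialgHom_antipode {k A A' : Type*} [Field k] [Ring A] [HopfAlgebra k A] [Ring A']
    [HopfAlgebra k A'] (f : A →ₐc[k] A') (a : A) :
    f (HopfAlgebra.antipode k a) = HopfAlgebra.antipode k (f a) := by
  have h1 := LinearMap.algHom_comp_convMul_distrib (f : A →ₐ[k] A')
    (toConv (HopfAlgebra.antipode k (A := A))) (toConv LinearMap.id)
  rw [LinearMap.antipode_mul_id] at h1
  have h2 := LinearMap.convMul_comp_coalgHom_distrib
    (toConv LinearMap.id) (toConv (HopfAlgebra.antipode k (A := A'))) (f : A →ₗc[k] A')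
  rw [LinearMap.id_mul_antipode] at h2
  have h1' : toConv ((f : A →ₐ[k] A').toLinearMap ∘ₗ HopfAlgebra.antipode k) *
      toConv (f : A →ₐ[k] A').toLinearMap = 1 := by
    apply WithConv.ofConv_injective
    refine Eq.trans h1.symm ?_
    ext b
    simpa [LinearMap.convOne_def] using AlgHomClass.commutes f _
  have h2' : toConv (f : A →ₐ[k] A').toLinearMap *
      toConv (HopfAlgebra.antipode k ∘ₗ (f : A →ₐ[k] A').toLinearMap) = 1 := by
    apply WithConv.ofConv_injective
    refine Eq.trans h2.symm ?_
    ext b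
    simp [LinearMap.convOne_def]
  exact LinearMap.congr_fun (congrArg WithConv.ofConv (left_inv_eq_right_inv h1' h2')) a

variable {k : Type*} [Field k]

/-- The generator goes to a group-like element, that is, to an element of C₃, and injectivity
excludes 1. -/
theorem groupAlgebra_end_eq {f : GA k (C 3) →ₐ[k] GA k (C 3)} (hf : Function.Injective f)
    (hε : ∀ b, counit (R := k) (f b) = counit (R := k) b)
    (hΔ : ∀ b, comul (R := k) (f b) = TensorProduct.map f.toLinearMap f.toLinearMap (comul b)) :
    f.toLinearMap = LinearMap.id ∨ f.toLinearMap = sq k := by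
  let x : C 3 := Multiplicative.ofAdd 1
  have hg : IsGroupLikeElem k (f (MonoidAlgebra.single x 1)) :=
    ⟨by simp [hε], by rw [hΔ]; simp⟩
  obtain ⟨a, ha⟩ := MonoidAlgebra.isGroupLikeElem_iff_mem_range_single_one.1 hg
  have hpow : ∀ n : ℕ, f (MonoidAlgebra.single (x ^ n) 1) = MonoidAlgebra.single (a ^ n) 1 :=
    fun n => by
      have := congrArg (· ^ n) ha
      simpa [MonoidAlgebra.single_pow, ← map_pow] using this.symm
  have hc : ∀ c : C 3, ∃ n : ℕ, c = x ^ n := by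
    have : ∀ c : C 3, c = x ^ 0 ∨ c = x ^ 1 ∨ c = x ^ 2 := by decide
    intro c
    rcases this c with h | h | h <;> exact ⟨_, h⟩
  have ha' : a = 1 ∨ a = x ∨ a = x ^ 2 := by
    have : ∀ a : C 3, a = 1 ∨ a = Multiplicative.ofAdd 1 ∨ a = Multiplicative.ofAdd 1 ^ 2 := by decide
    exact this a
  rcases ha' with rfl | rfl | rfl
  · have h1 : f (MonoidAlgebra.single x 1) = f 1 := by
      rw [← ha, map_one]
      rfl
    have h2 := MonoidAlgebra.single_left_injective (one_ne_zero) (hf h1)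
    exact absurd h2 (by decide)
  · left
    refine lext k fun c => ?_
    obtain ⟨n, rfl⟩ := hc c
    exact hpow n
  · right
    refine lext k fun c => ?_
    obtain ⟨n, rfl⟩ := hc c
    rw [sq_single, ← pow_mul, mul_comm, pow_mul]
    exact hpow n

namespace BraidedHopfAlgebra

variable {B : Type*} [Ring B] [Algebra k B] [Coalgebra k B]
  (S : BraidedHopfAlgebra k (GA k (C 2)) B)

variable {S} in
theorem comul_mul_of_braiding
    (hS : ∀ m n, S.braiding S.toYDModule (m ⊗ₜ n) = n ⊗ₜ m) (a b : B) :
    comul (R := k) (a * b) = comul a * comul b := by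
  have h := LinearMap.congr_fun S.comul_mul (a ⊗ₜ b)
  have h' : ∀ s t : B ⊗[k] B, TensorProduct.map (LinearMap.mul' k B) (LinearMap.mul' k B)
      (middle (S.braiding S.toYDModule) (s ⊗ₜ t)) = s * t := fun s t => by
    induction s with
    | zero => simp
    | add x y hx hy => rw [add_tmul, map_add, map_add, hx, hy, add_mul]
    | tmul x y =>
      induction t with
      | zero => simp
      | add x y hx hy => rw [tmul_add, map_add, map_add, hx, hy, mul_add]
      | tmul x' y' => simp [middle, hS]
  simpa [h'] using h

/-- A braided Hopf algebra with trivial braiding is a Hopf algebra. -/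
@[reducible]
def toHopfAlgebra (hS : ∀ m n, S.braiding S.toYDModule (m ⊗ₜ n) = n ⊗ₜ m) : HopfAlgebra k B :=
  letI := Bialgebra.mk' k B S.counit_one (fun {a b} => S.counit_mul a b) S.comul_one
    (fun {a b} => comul_mul_of_braiding hS a b)
  { antipode := S.antipode
    mul_antipode_rTensor_comul := S.antipode_left
    mul_antipode_lTensor_comul := S.antipode_right }

variable {S} in
/-- An isomorphism of bialgebras which is compatible with the antipodes and with the actions and
gradings of `C₂` is an isomorphism of braided Hopf algebras. -/
def isoOfInvolutions [CharZero k] {B' : Type*} [Ring B'] [Algebra k B'] [Coalgebra k B']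
    {T : BraidedHopfAlgebra k (GA k (C 2)) B'} (φ : B ≃ₐ[k] B')
    (hΔ : ∀ b : B, comul (R := k) (φ b) =
      TensorProduct.map φ.toLinearMap φ.toLinearMap (comul (R := k) b))
    (hε : ∀ b : B, counit (R := k) (φ b) = counit (R := k) b)
    (hS : ∀ b : B, φ (S.antipode b) = T.antipode (φ b))
    (hσ : ∀ b, φ (S.actG b) = T.actG (φ b)) (hγ : ∀ b, φ (S.grade b) = T.grade (φ b)) :
    S.Iso T where
  toAlgEquiv := φ
  map_comul := hΔ
  map_counit := hε
  map_antipode := hS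
  map_act h b := by
    induction h using MonoidAlgebra.induction_linear with
    | zero => simp
    | add x y hx hy => simp [hx, hy]
    | single c r =>
      rw [← mul_one r, ← smul_eq_mul, ← MonoidAlgebra.smul_single, map_smul, map_smul,
        LinearMap.smul_apply, LinearMap.smul_apply, map_smul, YDModule.act_single,
        YDModule.act_single]
      split_ifs
      · rfl
      · rw [hσ]
  map_coact b := by
    rw [YDModule.coact_eq, YDModule.coact_eq]
    simp [hγ]

end BraidedHopfAlgebra

theorem actG_BC6 (b : GA k (C 3)) : (BC6 k).actG b = b := by
  change trivialAct k _ b = b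
  simp [trivialAct_apply]

theorem actG_BStar [CharZero k] (b : GA k (C 3)) : (BStar k).actG b = b := by
  change trivialAct k _ b = b
  simp [trivialAct_apply]

theorem actG_BS3 (b : GA k (C 3)) : (BS3 k).actG b = sq k b := by
  change sqAct k _ b = _
  refine LinearMap.congr_fun (lext k fun a => ?_) b
  rw [sqAct_single, if_neg (by decide), sq_single]

theorem grade_BC6 (b : GA k (C 3)) : (BC6 k).grade b = b := by
  change sgnContract (trivialCoact k b) = b
  simp [trivialCoact_apply, sgnContract_tmul]

theorem grade_BS3 (b : GA k (C 3)) : (BS3 k).grade b = b := by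
  change sgnContract (trivialCoact k b) = b
  simp [trivialCoact_apply, sgnContract_tmul]

theorem grade_BStar [CharZero k] (b : GA k (C 3)) : (BStar k).grade b = sq k b := by
  change sgnContract (pPlus k ⊗ₜ b + pMinus k ⊗ₜ sq k b) = sq k b
  simp [sgnContract_tmul, sgn_pPlus, sgn_pMinus]

theorem nonempty_iso_of_trivial [IsAlgClosed k] [CharZero k] {B : Type*} [Ring B] [Algebra k B]
    [Coalgebra k B] (S : BraidedHopfAlgebra k (GA k (C 2)) B) (hB : Module.finrank k B = 3)
    (htriv : (∀ b, S.actG b = b) ∨ ∀ b, S.grade b = b) :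
    Nonempty (S.Iso (BC6 k)) ∨ Nonempty (S.Iso (BS3 k)) ∨ Nonempty (S.Iso (BStar k)) := by
  have hS : ∀ m n, S.braiding S.toYDModule (m ⊗ₜ n) = n ⊗ₜ m := fun m n => by
    rw [YDModule.braiding_tmul]
    rcases htriv with h | h
    · rw [h, sub_self, zero_tmul, add_zero, ← two_smul k n, ← smul_tmul', smul_smul]
      norm_num
    · rw [h, ← add_tmul, add_add_sub_cancel, ← two_smul k n, ← smul_tmul', smul_smul]
      norm_num
  let _ := S.toHopfAlgebra hS
  obtain ⟨φ⟩ := nonempty_bialgEquiv (k := k) (B := B) hB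
  have hφΔ : ∀ b : B, comul (R := k) (φ b) =
      TensorProduct.map φ.toAlgEquiv.toLinearMap φ.toAlgEquiv.toLinearMap (comul (R := k) b) :=
    fun b => (LinearMap.congr_fun φ.map_comp_comul b).symm
  have hφε : ∀ b : B, counit (R := k) (φ b) = counit (R := k) b :=
    fun b => LinearMap.congr_fun φ.counit_comp b
  have hφS : ∀ b : B, φ (S.antipode b) = HopfAlgebra.antipode k (φ b) :=
    bialgHom_antipode φ.toBialgHom
  -- Conjugation by φ turns each involution into a bialgebra automorphism of k[C₃].
  have transport : ∀ f : B →ₗ[k] B, Function.Involutive f → f 1 = 1 →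
      (∀ a b, f (a * b) = f a * f b) → (∀ b, counit (R := k) (f b) = counit (R := k) b) →
      (∀ b, comul (R := k) (f b) = TensorProduct.map f f (comul b)) →
      (∀ b, φ (f b) = φ b) ∨ ∀ b, φ (f b) = sq k (φ b) := by
    intro f hff hf1 hfm hfε hfΔ
    let F : GA k (C 3) →ₐ[k] GA k (C 3) := (φ.toAlgEquiv.toAlgHom.comp
      (AlgHom.ofLinearMap f hf1 hfm)).comp φ.symm.toAlgEquiv.toAlgHom
    have hF : ∀ b, F (φ b) = φ (f b) := fun b => congrArg (fun y => φ (f y)) (φ.symm_apply_apply b)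
    have hsurj : ∀ c, ∃ b, φ b = c := φ.surjective
    have := groupAlgebra_end_eq (f := F)
      (fun c d h => by
        obtain ⟨c, rfl⟩ := hsurj c
        obtain ⟨d, rfl⟩ := hsurj d
        rw [hF, hF] at h
        rw [hff.injective (φ.injective h)])
      (fun c => by
        obtain ⟨c, rfl⟩ := hsurj c
        rw [hF, hφε, hφε, hfε])
      (fun c => by
        obtain ⟨c, rfl⟩ := hsurj c
        rw [hF, hφΔ, hφΔ, hfΔ, TensorProduct.map_map, TensorProduct.map_map]
        congr 2 <;> exact LinearMap.ext fun b => (hF b).symm)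
    refine this.imp (fun h b => ?_) fun h b => ?_
    · exact (hF b).symm.trans (LinearMap.congr_fun h (φ b))
    · exact (hF b).symm.trans (LinearMap.congr_fun h (φ b))
  have hσ := transport S.actG S.actG_actG S.actG_one S.actG_mul S.counit_actG S.comul_actG
  have hγ := transport S.grade S.grade_grade S.grade_one S.grade_mul S.counit_grade S.comul_grade
  rcases hσ with hσ | hσ <;> rcases hγ with hγ | hγ
  · exact .inl ⟨BraidedHopfAlgebra.isoOfInvolutions φ.toAlgEquiv hφΔ hφε hφS
      (fun b => (hσ b).trans (actG_BC6 _).symm) fun b => (hγ b).trans (grade_BC6 _).symm⟩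
  · exact .inr (.inr ⟨BraidedHopfAlgebra.isoOfInvolutions φ.toAlgEquiv hφΔ hφε hφS
      (fun b => (hσ b).trans (actG_BStar _).symm) fun b => (hγ b).trans (grade_BStar _).symm⟩)
  · exact .inr (.inl ⟨BraidedHopfAlgebra.isoOfInvolutions φ.toAlgEquiv hφΔ hφε hφS
      (fun b => (hσ b).trans (actG_BS3 _).symm) fun b => (hγ b).trans (grade_BS3 _).symm⟩)
  -- Both involutions acting as x ↦ x² contradicts `htriv`.
  · have hsq : ∃ b, φ b ≠ sq k (φ b) := by
      obtain ⟨b, hb⟩ : ∃ b, φ b = MonoidAlgebra.single (Multiplicative.ofAdd 1) 1 :=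
        φ.surjective _
      refine ⟨b, fun h => ?_⟩
      rw [hb, sq_single] at h
      exact absurd (MonoidAlgebra.single_left_injective one_ne_zero h) (by decide)
    obtain ⟨b, hb⟩ := hsq
    rcases htriv with h | h
    · exact (hb (by rw [← hσ, h])).elim
    · exact (hb (by rw [← hγ, h])).elim

end TrivialBraiding

/-! ### Braided Hopf algebras of dimension three with nontrivial braiding -/

section NontrivialBraiding

open Coalgebra

variable {k : Type*} [Field k]

/-- The scalars come from a superalgebra with even e and odd w: w² = αe, e² = βe, ew = γw, we = δw,
Δw = w⊗1 + 1⊗w + p e⊗w + q w⊗e, Δe = e⊗1 + 1⊗e + r w⊗w + s e⊗e. -/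
theorem false_of_structure_constants [CharZero k] {α β γ δ s r p q : k} (hγ : γ * γ = β * γ)
    (hδ : δ * δ = β * δ) (hq : q * q = q * s) (hrq : r * q = r * s) (hrp : r * p = r * s)
    (hee : 2 + 4 * (s * β) + s * β * (s * β) - r * α * (r * α) = β * s)
    (heeww : r * (2 * γ + 2 * δ + s * (γ * γ) + s * (δ * δ)) = β * r)
    (hewwe : r = 0 → (1 + q * β) * (1 + s * γ) = 0)
    (hww : (1 + p * δ) * (1 + q * γ) - (1 + p * γ) * (1 + q * δ) = α * r)
    (hS : r * α = 0 → 1 + s * β ≠ 0) : False := by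
  -- For r ≠ 0 one has p = q = s, and the left side of `hww` cancels.
  have hrα : r * α = 0 := by
    by_cases hr : r = 0
    · rw [hr, zero_mul]
    · rw [mul_left_cancel₀ hr hrq, mul_left_cancel₀ hr hrp] at hww
      linear_combination -hww
  have hsβ : s * β = -2 := by
    have h : (1 + s * β) * (2 + s * β) = 0 := by
      linear_combination hee + r * α * hrα
    linear_combination (mul_eq_zero.1 h).resolve_left (hS hrα)
  have hzero : ∀ t : k, t * t = β * t → t = 0 ∨ t = β := fun t h => by
    have : t * (t - β) = 0 := by linear_combination h
    exact (mul_eq_zero.1 this).imp_right sub_eq_zero.1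
  -- For r = 0, q is 0 or s and γ is 0 or β; as sβ = -2, both factors in `hewwe` are ±1. For r ≠ 0,
  -- substituting sβ = -2 in `heeww` leaves βr = 0.
  by_cases hr : r = 0
  · rcases mul_eq_zero.1 (hewwe hr) with h | h
    · have hq0 : q ≠ 0 := by rintro rfl; norm_num at h
      rw [mul_left_cancel₀ hq0 hq, hsβ] at h
      norm_num at h
    · rcases hzero γ hγ with rfl | rfl
      · norm_num at h
      · rw [hsβ] at h
        norm_num at h
  · have hβ : β = 0 := by
      apply mul_right_cancel₀ hr
      rw [← heeww, hγ, hδ]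
      linear_combination r * (γ + δ) * hsβ
    rw [hβ] at hsβ
    norm_num at hsβ

variable {B : Type*} [Ring B] [Algebra k B] [Coalgebra k B]
  (S : BraidedHopfAlgebra k (GA k (C 2)) B)

namespace BraidedHopfAlgebra

/-- The multiplication of the braided tensor product algebra `B ⊗ B`. -/
def braidedMul : B ⊗[k] B →ₗ[k] B ⊗[k] B →ₗ[k] B ⊗[k] B :=
  TensorProduct.curry (TensorProduct.map (LinearMap.mul' k B) (LinearMap.mul' k B) ∘ₗ
    middle (S.braiding S.toYDModule))

theorem comul_mul_eq (a b : B) :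
    comul (R := k) (a * b) = S.braidedMul (comul a) (comul b) := by
  simpa [braidedMul] using LinearMap.congr_fun S.comul_mul (a ⊗ₜ b)

variable [CharZero k]

theorem braidedMul_tmul (x y z t : B) : S.braidedMul (x ⊗ₜ y) (z ⊗ₜ t) =
    (2⁻¹ : k) • ((x * (z + S.actG z)) ⊗ₜ (y * t) + (x * (z - S.actG z)) ⊗ₜ (S.grade y * t)) := by
  simp only [braidedMul, middle, TensorProduct.curry_apply, LinearMap.comp_apply,
    LinearEquiv.coe_coe, TensorProduct.tensorTensorTensorAssoc_tmul, LinearMap.rTensor_tmul,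
    LinearMap.lTensor_tmul, YDModule.braiding_tmul, tmul_add, tmul_smul, add_tmul, ← smul_tmul',
    map_add, map_smul, TensorProduct.tensorTensorTensorAssoc_symm_tmul, TensorProduct.map_tmul,
    LinearMap.mul'_apply, mul_add]

theorem braidedMul_tmul_of_actG {z : B} (hz : S.actG z = z) (x y t : B) :
    S.braidedMul (x ⊗ₜ y) (z ⊗ₜ t) = (x * z) ⊗ₜ (y * t) := by
  rw [braidedMul_tmul, hz, sub_self, mul_zero, zero_tmul, add_zero, ← two_smul k z,
    mul_smul_comm, ← smul_tmul', smul_smul]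
  norm_num

theorem braidedMul_tmul_of_grade {y : B} (hy : S.grade y = y) (x z t : B) :
    S.braidedMul (x ⊗ₜ y) (z ⊗ₜ t) = (x * z) ⊗ₜ (y * t) := by
  rw [braidedMul_tmul, hy, ← add_tmul, ← mul_add, add_add_sub_cancel, ← two_smul k z,
    mul_smul_comm, ← smul_tmul', smul_smul]
  norm_num

theorem braidedMul_tmul_of_neg {y z : B} (hy : S.grade y = -y) (hz : S.actG z = -z) (x t : B) :
    S.braidedMul (x ⊗ₜ y) (z ⊗ₜ t) = -((x * z) ⊗ₜ (y * t)) := by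
  rw [braidedMul_tmul, hy, hz, add_neg_cancel, mul_zero, zero_tmul, zero_add, sub_neg_eq_add,
    ← two_smul k z, mul_smul_comm, ← smul_tmul', smul_smul, neg_mul, tmul_neg]
  norm_num

/-- For an involution f, the vectors y + fy and y - fy sum to 2y, so one of them avoids the line kw.
Doing this for σ and then γ works because they commute; the line need not be stable. -/
theorem exists_eigenvector {w y : B} (hy : counit (R := k) y = 0) (hyw : y ∉ Submodule.span k {w}) :
    ∃ v, counit (R := k) v = 0 ∧ v ∉ Submodule.span k {w} ∧
      (S.actG v = v ∨ S.actG v = -v) ∧ (S.grade v = v ∨ S.grade v = -v) := by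
  have step : ∀ (f : B →ₗ[k] B), Function.Involutive f →
      (∀ b, counit (R := k) (f b) = counit (R := k) b) → ∀ y : B, counit (R := k) y = 0 →
      y ∉ Submodule.span k {w} → ∃ c : k, counit (R := k) (y + c • f y) = 0 ∧
      y + c • f y ∉ Submodule.span k {w} ∧
        (f (y + c • f y) = y + c • f y ∨ f (y + c • f y) = -(y + c • f y)) := by
    intro f hf hfε y hy hyw
    have hor : y + (1 : k) • f y ∉ Submodule.span k {w} ∨
        y + (-1 : k) • f y ∉ Submodule.span k {w} := by
      by_contra! h
      apply hyw
      have := Submodule.smul_mem _ (2⁻¹ : k) (Submodule.add_mem _ h.1 h.2)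
      convert this using 1
      module
    rcases hor with h | h
    · exact ⟨1, by simp [hy, hfε], h, .inl (by simp [hf y, add_comm])⟩
    · exact ⟨-1, by simp [hy, hfε], h, .inr (by simp [hf y, add_comm])⟩
  obtain ⟨c, h1, h2, h3⟩ := step S.actG S.actG_actG S.counit_actG y hy hyw
  generalize y + c • S.actG y = y at h1 h2 h3
  obtain ⟨c, h4, h5, h6⟩ := step S.grade S.grade_grade S.counit_grade y h1 h2
  refine ⟨_, h4, h5, ?_, h6⟩
  rcases h3 with h3 | h3
  · left
    rw [map_add, map_smul, S.actG_grade, h3]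
  · right
    rw [map_add, map_smul, S.actG_grade, h3, map_neg]
    module

end BraidedHopfAlgebra

end NontrivialBraiding

/-! ### Coordinates in a homogeneous basis. -/

section NontrivialBraiding

open Coalgebra

variable {k : Type*} [Field k]

section Coordinates

variable {B : Type*} [Ring B] [Algebra k B] (β : Module.Basis (Fin 3) k B)

/-- The coordinates on `B ⊗ B` with respect to a basis of `B`. -/
def coord₂ (i j : Fin 3) : B ⊗[k] B →ₗ[k] k :=
  (TensorProduct.lid k k).toLinearMap ∘ₗ TensorProduct.map (β.coord i) (β.coord j)

theorem coord₂_tmul (i j : Fin 3) (x y : B) :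
    coord₂ β i j (x ⊗ₜ y) = β.coord i x * β.coord j y := by
  simp [coord₂]

theorem eq_sum_coord₂ (t : B ⊗[k] B) : t = ∑ i, ∑ j, coord₂ β i j t • (β i ⊗ₜ[k] β j) := by
  induction t with
  | zero => simp
  | tmul x y =>
    simp only [coord₂_tmul, ← smul_tmul_smul, Module.Basis.coord_apply]
    simp only [← tmul_sum, ← sum_tmul, β.sum_repr]
  | add s t hs ht =>
    conv_lhs => rw [hs, ht]
    simp only [map_add, add_smul, Finset.sum_add_distrib]

variable {β} {f : B →ₗ[k] B} {s : Fin 3 → k}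

theorem coord_of_diagonal (hf : ∀ i, f (β i) = s i • β i) (i : Fin 3) (x : B) :
    β.coord i (f x) = s i * β.coord i x := by
  have h : β.coord i ∘ₗ f = s i • β.coord i := β.ext fun j => by
    by_cases hij : j = i
    · subst hij; simp [hf]
    · simp [hf, hij]
  exact LinearMap.congr_fun h x

/-- Multiplication preserves the grading by eigenvalues of f, so components of the wrong sign
vanish. -/
theorem coord_mul_eq_zero (hf : ∀ i, f (β i) = s i • β i) (hm : ∀ a b, f (a * b) = f a * f b)
    {i j l : Fin 3} (h : s i * s j ≠ s l) : β.coord l (β i * β j) = 0 := by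
  have h1 := coord_of_diagonal hf l (β i * β j)
  rw [hm, hf, hf, smul_mul_smul_comm, map_smul, smul_eq_mul] at h1
  have h2 : (s i * s j - s l) * β.coord l (β i * β j) = 0 := by linear_combination h1
  exact (mul_eq_zero.1 h2).resolve_left (sub_ne_zero.2 h)

variable [Coalgebra k B]

theorem coord₂_comul_eq_zero (hf : ∀ i, f (β i) = s i • β i)
    (hΔ : ∀ b, comul (R := k) (f b) = TensorProduct.map f f (comul b))
    {i j l : Fin 3} (h : s i * s j ≠ s l) : coord₂ β i j (comul (β l)) = 0 := by
  have h0 : ∀ t, coord₂ β i j (TensorProduct.map f f t) = s i * s j * coord₂ β i j t := fun t => by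
    induction t with
    | zero => simp
    | tmul x y =>
      rw [TensorProduct.map_tmul, coord₂_tmul, coord₂_tmul, coord_of_diagonal hf,
        coord_of_diagonal hf]
      ring
    | add s t hs ht => simp only [map_add, hs, ht, mul_add]
  have h1 := congrArg (coord₂ β i j) (hΔ (β l))
  rw [h0, hf, map_smul, map_smul, smul_eq_mul] at h1
  have h2 : (s i * s j - s l) * coord₂ β i j (comul (β l)) = 0 := by linear_combination -h1
  exact (mul_eq_zero.1 h2).resolve_left (sub_ne_zero.2 h)

theorem coord_zero_eq_counit (h1 : counit (R := k) (1 : B) = 1) (hβ0 : β 0 = 1)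
    (hβ1 : counit (R := k) (β 1) = 0) (hβ2 : counit (R := k) (β 2) = 0) (x : B) :
    β.coord 0 x = counit (R := k) x := by
  have h : β.coord 0 = counit (R := k) := β.ext fun j => by
    fin_cases j
    · change β.coord 0 (β 0) = counit (R := k) (β 0)
      rw [hβ0, h1, ← hβ0]
      simp
    · simp [hβ1]
    · simp [hβ2]
  exact LinearMap.congr_fun h x

theorem eq_of_counit_eq_zero (hβ : ∀ x, β.coord 0 x = counit (R := k) x) {x : B}
    (hx : counit (R := k) x = 0) :
    x = β.coord 1 x • β 1 + β.coord 2 x • β 2 := by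
  have h := β.sum_repr x
  rw [Fin.sum_univ_three] at h
  rw [← hβ, Module.Basis.coord_apply] at hx
  rw [hx, zero_smul, zero_add] at h
  exact h.symm

/-- The coordinate of index 0 is ε, so the counit axioms fix every coefficient involving β 0 = 1;
only the four in ker ε ⊗ ker ε remain free. -/
theorem comul_eq_of_counit_eq_zero (hβ : ∀ x, β.coord 0 x = counit (R := k) x)
    (hβ0 : β 0 = 1) {x : B} (hx : counit (R := k) x = 0) :
    comul x = x ⊗ₜ[k] 1 + 1 ⊗ₜ[k] x +
      (coord₂ β 1 1 (comul x) • (β 1 ⊗ₜ[k] β 1) + coord₂ β 1 2 (comul x) • (β 1 ⊗ₜ[k] β 2) +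
       (coord₂ β 2 1 (comul x) • (β 2 ⊗ₜ[k] β 1) + coord₂ β 2 2 (comul x) • (β 2 ⊗ₜ[k] β 2))) := by
  have hl : ∀ (t : B ⊗[k] B) (j : Fin 3), coord₂ β 0 j t =
      β.coord j (TensorProduct.lid k B ((counit (R := k)).rTensor B t)) := fun t j => by
    induction t with
    | zero => simp
    | tmul x y => rw [coord₂_tmul, hβ]; simp
    | add s t hs ht => simp only [map_add, hs, ht]
  have hr : ∀ (t : B ⊗[k] B) (i : Fin 3), coord₂ β i 0 t =
      β.coord i (TensorProduct.rid k B ((counit (R := k)).lTensor B t)) := fun t j => by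
    induction t with
    | zero => simp
    | tmul x y => rw [coord₂_tmul, hβ]; simp [mul_comm]
    | add s t hs ht => simp only [map_add, hs, ht]
  have hl' : ∀ j, coord₂ β 0 j (comul x) = β.coord j x := fun j => by
    rw [hl, Coalgebra.rTensor_counit_comul, TensorProduct.lid_tmul, one_smul]
  have hr' : ∀ i, coord₂ β i 0 (comul x) = β.coord i x := fun i => by
    rw [hr, Coalgebra.lTensor_counit_comul, TensorProduct.rid_tmul, one_smul]
  have h := eq_sum_coord₂ β (comul (R := k) x)
  simp only [Fin.sum_univ_three, hl', hr', hβ, hx, hβ0] at h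
  have e1 : x ⊗ₜ[k] (1 : B) = β.coord 1 x • (β 1 ⊗ₜ[k] 1) + β.coord 2 x • (β 2 ⊗ₜ[k] 1) := by
    conv_lhs => rw [eq_of_counit_eq_zero hβ hx, add_tmul, ← smul_tmul', ← smul_tmul']
  have e2 : (1 : B) ⊗ₜ[k] x = β.coord 1 x • (1 ⊗ₜ[k] β 1) + β.coord 2 x • (1 ⊗ₜ[k] β 2) := by
    conv_lhs => rw [eq_of_counit_eq_zero hβ hx, tmul_add, tmul_smul, tmul_smul]
  rw [e1, e2]
  refine h.trans ?_
  module

end Coordinates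

end NontrivialBraiding

/-! ### Exclusion of the nontrivial braiding. -/

section NontrivialBraiding

open Coalgebra

variable {k : Type*} [Field k] [CharZero k]

namespace BraidedHopfAlgebra

variable {B : Type*} [Ring B] [Algebra k B] [Coalgebra k B]
  (S : BraidedHopfAlgebra k (GA k (C 2)) B)

variable {S} in
theorem false_of_no_invariants {β : Module.Basis (Fin 3) k B} (hβ0 : β 0 = 1)
    (hβ : ∀ x, β.coord 0 x = counit (R := k) x) {s t : Fin 3 → k}
    (hs : ∀ i, S.actG (β i) = s i • β i) (ht : ∀ i, S.grade (β i) = t i • β i)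
    (hs1 : ∀ i, s i = 1 ∨ s i = -1) (ht1 : ∀ i, t i = 1 ∨ t i = -1)
    (hst : ∀ i, i ≠ 0 → ¬(s i = 1 ∧ t i = 1)) : False := by
  have sign : ∀ r : Fin 3 → k, (∀ i, r i = 1 ∨ r i = -1) → ∀ i j l : Fin 3,
      i ≠ 0 → j ≠ 0 → l ≠ 0 → r i * r j = r l → (i = j → r l = 1) ∧ (l = i → r j = 1) ∧
      (l = j → r i = 1) := by
    intro r hr i j l hi hj hl h
    have h0 : ∀ i, r i ≠ 0 := fun i => by rcases hr i with h | h <;> rw [h] <;> norm_num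
    refine ⟨?_, ?_, ?_⟩
    · rintro rfl
      rw [← h]
      rcases hr i with h | h <;> rw [h] <;> norm_num
    · rintro rfl
      exact mul_left_cancel₀ (h0 l) (by rw [h, mul_one])
    · rintro rfl
      exact mul_right_cancel₀ (h0 l) (by rw [h, one_mul])
  -- Two of three indices in {1, 2} coincide; if both signs were compatible, the remaining vector
  -- would be fixed by σ and γ.
  have key : ∀ i j l : Fin 3, i ≠ 0 → j ≠ 0 → l ≠ 0 → s i * s j ≠ s l ∨ t i * t j ≠ t l := by
    intro i j l hi hj hl
    by_contra! h
    obtain ⟨a1, a2, a3⟩ := sign s hs1 i j l hi hj hl h.1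
    obtain ⟨b1, b2, b3⟩ := sign t ht1 i j l hi hj hl h.2
    have : i = j ∨ l = i ∨ l = j := by omega
    rcases this with h | h | h
    · exact hst l hl ⟨a1 h, b1 h⟩
    · exact hst j hj ⟨a2 h, b2 h⟩
    · exact hst i hi ⟨a3 h, b3 h⟩
  have hε : ∀ i, i ≠ 0 → counit (R := k) (β i) = 0 := fun i hi => by
    rw [← hβ]
    simp [hi]
  have hmul : ∀ i j, i ≠ 0 → j ≠ 0 → β i * β j = 0 := fun i j hi hj => by
    have hc : ∀ l, l ≠ 0 → β.coord l (β i * β j) = 0 := fun l hl =>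
      (key i j l hi hj hl).elim (coord_mul_eq_zero hs S.actG_mul) (coord_mul_eq_zero ht S.grade_mul)
    rw [eq_of_counit_eq_zero hβ (x := β i * β j) (by rw [S.counit_mul, hε i hi, zero_mul]),
      hc 1 (by decide), hc 2 (by decide), zero_smul, zero_smul, add_zero]
  have hΔ : ∀ l, l ≠ 0 → comul (β l) = β l ⊗ₜ[k] 1 + 1 ⊗ₜ[k] β l := fun l hl => by
    have hc : ∀ i j, i ≠ 0 → j ≠ 0 → coord₂ β i j (comul (β l)) = 0 := fun i j hi hj =>
      (key i j l hi hj hl).elim (coord₂_comul_eq_zero hs S.comul_actG)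
        (coord₂_comul_eq_zero ht S.comul_grade)
    rw [comul_eq_of_counit_eq_zero hβ hβ0 (hε l hl), hc, hc, hc, hc] <;> simp
  -- The mixed terms of Δ(β i)Δ(β j), which must vanish since β i β j = 0 and both factors are
  -- primitive.
  have hprod : ∀ i j, i ≠ 0 → j ≠ 0 →
      β i ⊗ₜ[k] β j + S.braidedMul (1 ⊗ₜ β i) (β j ⊗ₜ 1) = 0 := fun i j hi hj => by
    have h := S.comul_mul_eq (β i) (β j)
    rw [hmul i j hi hj, map_zero, hΔ i hi, hΔ j hj] at h
    simp only [map_add, LinearMap.add_apply, S.braidedMul_tmul_of_grade S.grade_one,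
      S.braidedMul_tmul_of_actG S.actG_one, one_mul, mul_one, hmul i j hi hj, zero_tmul,
      tmul_zero] at h
    simpa [add_comm] using h.symm
  -- If either sign of β i were 1, the mixed terms for i = j would be 2 β i ⊗ β i.
  have hneg : ∀ i, i ≠ 0 → s i = -1 ∧ t i = -1 := fun i hi => by
    by_contra hcon
    have hp := hprod i i hi hi
    have hflip : S.braidedMul (1 ⊗ₜ β i) (β i ⊗ₜ 1) = β i ⊗ₜ[k] β i := by
      by_cases h1 : s i = 1
      · rw [S.braidedMul_tmul_of_actG (by rw [hs, h1, one_smul]), one_mul, mul_one]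
      · have h2 : t i = 1 := (ht1 i).resolve_right fun h => hcon ⟨(hs1 i).resolve_left h1, h⟩
        rw [S.braidedMul_tmul_of_grade (by rw [ht, h2, one_smul]), one_mul, mul_one]
    rw [hflip] at hp
    have h2 := congrArg (coord₂ β i i) hp
    rw [map_add, coord₂_tmul, map_zero] at h2
    simp at h2
  -- With all signs -1 this says β 1 ⊗ β 2 = β 2 ⊗ β 1.
  have hp := hprod 1 2 (by decide) (by decide)
  rw [S.braidedMul_tmul_of_neg (by rw [ht, (hneg 1 (by decide)).2, neg_one_smul])
    (by rw [hs, (hneg 2 (by decide)).1, neg_one_smul]), one_mul, mul_one] at hp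
  have h2 := congrArg (coord₂ β 1 2) hp
  rw [map_add, map_neg, coord₂_tmul, coord₂_tmul, map_zero] at h2
  simp at h2

variable {S} in
-- Here w = β 1 is odd and e = β 2 is even. Parity leaves eight structure constants, and
-- associativity, coassociativity, multiplicativity of Δ and the antipode supply the hypotheses of
-- `false_of_structure_constants`, with `b` and `c` in the roles of β and s there.
theorem false_of_super {β : Module.Basis (Fin 3) k B} (hβ0 : β 0 = 1)
    (hβ : ∀ x, β.coord 0 x = counit (R := k) x) {s : Fin 3 → k} (hs1 : s 1 = -1)
    (hs2 : s 2 = 1) (hs : ∀ i, S.actG (β i) = s i • β i) (ht : ∀ i, S.grade (β i) = s i • β i) :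
    False := by
  have hε : ∀ i, i ≠ 0 → counit (R := k) (β i) = 0 := fun i hi => by
    rw [← hβ]
    simp [hi]
  have hexp : ∀ i j, i ≠ 0 → j ≠ 0 → β i * β j =
      β.coord 1 (β i * β j) • β 1 + β.coord 2 (β i * β j) • β 2 := fun i j hi hj =>
    eq_of_counit_eq_zero hβ (by rw [S.counit_mul, hε i hi, zero_mul])
  have hc : ∀ i j l, s i * s j ≠ s l → β.coord l (β i * β j) = 0 := fun i j l h =>
    coord_mul_eq_zero hs S.actG_mul h
  have hexp₂ := fun i (hi : i ≠ 0) => comul_eq_of_counit_eq_zero hβ hβ0 (hε i hi)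
  have hc₂ : ∀ i j l, s i * s j ≠ s l → coord₂ β i j (comul (β l)) = 0 := fun i j l h =>
    coord₂_comul_eq_zero hs S.comul_actG h
  have hww := hexp 1 1 (by decide) (by decide)
  have hwe := hexp 1 2 (by decide) (by decide)
  have hew := hexp 2 1 (by decide) (by decide)
  have hee := hexp 2 2 (by decide) (by decide)
  have hΔw := hexp₂ 1 (by decide)
  have hΔe := hexp₂ 2 (by decide)
  rw [hc 1 1 1 (by rw [hs1]; norm_num), zero_smul, zero_add] at hww
  rw [hc 1 2 2 (by rw [hs1, hs2]; norm_num), zero_smul, add_zero] at hwe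
  rw [hc 2 1 2 (by rw [hs1, hs2]; norm_num), zero_smul, add_zero] at hew
  rw [hc 2 2 1 (by rw [hs1, hs2]; norm_num), zero_smul, zero_add] at hee
  rw [hc₂ 1 1 1 (by rw [hs1]; norm_num), hc₂ 2 2 1 (by rw [hs1, hs2]; norm_num), zero_smul,
    zero_smul, zero_add, add_zero] at hΔw
  rw [hc₂ 1 2 2 (by rw [hs1, hs2]; norm_num), hc₂ 2 1 2 (by rw [hs1, hs2]; norm_num), zero_smul,
    zero_smul, zero_add, add_zero] at hΔe
  generalize β.coord 2 (β 1 * β 1) = α at hww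
  generalize β.coord 1 (β 1 * β 2) = δ at hwe
  generalize β.coord 1 (β 2 * β 1) = γ at hew
  generalize β.coord 2 (β 2 * β 2) = b at hee
  generalize coord₂ β 2 1 (comul (β 1)) = p at hΔw
  generalize coord₂ β 1 2 (comul (β 1)) = q at hΔw
  generalize coord₂ β 1 1 (comul (β 2)) = r at hΔe
  generalize coord₂ β 2 2 (comul (β 2)) = c at hΔe
  have c00 : β.coord 0 1 = 1 := by rw [← hβ0]; simp
  have c10 : β.coord 1 1 = 0 := by rw [← hβ0]; simp
  have c20 : β.coord 2 1 = 0 := by rw [← hβ0]; simp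
  have cc : ∀ i j, β.coord i (β j) = if j = i then 1 else 0 := fun i j => by
    simp [Finsupp.single_apply]
  have hw0 : β 1 ≠ 0 := β.ne_zero 1
  have m1 : ∀ x z t : B, S.braidedMul (x ⊗ₜ 1) (z ⊗ₜ t) = (x * z) ⊗ₜ t := fun x z t => by
    rw [S.braidedMul_tmul_of_grade S.grade_one, one_mul]
  have m2 : ∀ x z t : B, S.braidedMul (x ⊗ₜ β 2) (z ⊗ₜ t) = (x * z) ⊗ₜ (β 2 * t) := fun x z t =>
    S.braidedMul_tmul_of_grade (by rw [ht, hs2, one_smul]) ..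
  have m3 : ∀ x y t : B, S.braidedMul (x ⊗ₜ y) (1 ⊗ₜ t) = x ⊗ₜ (y * t) := fun x z t => by
    rw [S.braidedMul_tmul_of_actG S.actG_one, mul_one]
  have m4 : ∀ x y t : B, S.braidedMul (x ⊗ₜ y) (β 2 ⊗ₜ t) = (x * β 2) ⊗ₜ (y * t) := fun x z t =>
    S.braidedMul_tmul_of_actG (by rw [hs, hs2, one_smul]) ..
  have m5 : ∀ x t : B, S.braidedMul (x ⊗ₜ β 1) (β 1 ⊗ₜ t) = -((x * β 1) ⊗ₜ (β 1 * t)) :=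
    fun x t => S.braidedMul_tmul_of_neg (by rw [ht, hs1, neg_one_smul])
      (by rw [hs, hs1, neg_one_smul]) x t
  have hγ : γ * γ = b * γ := by
    have h := mul_assoc (β 2) (β 2) (β 1)
    rw [hee, hew, smul_mul_assoc, mul_smul_comm, hew, smul_smul, smul_smul] at h
    exact (smul_left_injective k hw0 h).symm
  have hδ : δ * δ = b * δ := by
    have h := mul_assoc (β 1) (β 2) (β 2)
    rw [hee, hwe, smul_mul_assoc, mul_smul_comm, hwe, smul_smul, smul_smul] at h
    exact smul_left_injective k hw0 h
  have hEE := S.comul_mul_eq (β 2) (β 2)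
  have hWW := S.comul_mul_eq (β 1) (β 1)
  have hEW := S.comul_mul_eq (β 2) (β 1)
  simp only [hee, hww, hew, map_smul, hΔw, hΔe, map_add, LinearMap.add_apply, LinearMap.smul_apply,
    m1, m2, m3, m4, m5, one_mul, mul_one, hwe] at hEE hWW hEW
  have hEE22 := congrArg (coord₂ β 2 2) hEE
  have hEE11 := congrArg (coord₂ β 1 1) hEE
  have hWW11 := congrArg (coord₂ β 1 1) hWW
  have hEW12 := congrArg (coord₂ β 1 2) hEW
  simp [coord₂_tmul, c10, c20, cc, -Module.Basis.coord_apply] at hEE22 hEE11 hWW11 hEW12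
  let T : Fin 3 → Fin 3 → Fin 3 → B ⊗[k] (B ⊗[k] B) →ₗ[k] k := fun i j l =>
    (TensorProduct.lid k k).toLinearMap ∘ₗ TensorProduct.map (β.coord i) (coord₂ β j l)
  have hT : ∀ i j l x t, T i j l (x ⊗ₜ t) = β.coord i x * coord₂ β j l t := fun i j l x t => by
    simp [T]
  have hcW := Coalgebra.coassoc_apply (R := k) (β 1)
  have hcE := Coalgebra.coassoc_apply (R := k) (β 2)
  simp only [hΔw, hΔe, map_add, map_smul, LinearMap.rTensor_tmul, LinearMap.lTensor_tmul,
    S.comul_one, add_tmul, tmul_add, ← smul_tmul', tmul_smul, TensorProduct.assoc_tmul] at hcW hcE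
  have hW122 := congrArg (T 1 2 2) hcW
  have hE112 := congrArg (T 1 1 2) hcE
  have hE211 := congrArg (T 2 1 1) hcE
  simp [hT, coord₂_tmul, c10, c20, cc, -Module.Basis.coord_apply] at hW122 hE112 hE211
  have hS1 : S.antipode 1 = 1 := by
    have h := LinearMap.congr_fun S.antipode_left 1
    simpa [S.comul_one, S.counit_one] using h
  -- The coefficients of 1 and e in S(e) + e + r S(w)w + c S(e)e = 0 show that 1 + cb ≠ 0 once rα =
  -- 0.
  have hSe := LinearMap.congr_fun S.antipode_left (β 2)
  have hse := β.sum_repr (S.antipode (β 2))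
  have hsw := β.sum_repr (S.antipode (β 1))
  rw [Fin.sum_univ_three, hβ0] at hse hsw
  generalize β.repr (S.antipode (β 2)) 0 = x0 at hse
  generalize β.repr (S.antipode (β 2)) 1 = x1 at hse
  generalize β.repr (S.antipode (β 2)) 2 = x2 at hse
  generalize β.repr (S.antipode (β 1)) 0 = y0 at hsw
  generalize β.repr (S.antipode (β 1)) 1 = y1 at hsw
  generalize β.repr (S.antipode (β 1)) 2 = y2 at hsw
  simp only [LinearMap.comp_apply, hΔe, map_add, map_smul, LinearMap.rTensor_tmul, hS1, ← hse,
    ← hsw, LinearMap.mul'_apply, hε 2 (by decide), add_mul, smul_mul_assoc, one_mul, mul_one,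
    hee, hew, hwe, hww, map_zero] at hSe
  have hSe0 := congrArg (β.coord 0) hSe
  have hSe2 := congrArg (β.coord 2) hSe
  simp [c00, c20, cc, -Module.Basis.coord_apply] at hSe0 hSe2
  refine false_of_structure_constants (α := α) (β := b) (γ := γ) (δ := δ) (s := c) (r := r) (p := p)
    (q := q) hγ hδ ?_ ?_ ?_ ?_ ?_ ?_ ?_ ?_
  · rcases hW122 with rfl | rfl <;> ring
  · linear_combination -hE112
  · linear_combination hE211
  · linear_combination -hEE22
  · linear_combination -hEE11
  · intro hr
    rw [hr] at hEW12
    linear_combination -hEW12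
  · linear_combination -hWW11
  · intro hrα h
    have h1 : (1 : k) = 0 := by linear_combination hSe2 - y1 * hrα - c * hSe0 - x2 * h
    exact one_ne_zero h1

/-- If one basis vector of ker ε is fixed by both involutions, the nontriviality of each forces both
signs of the other vector to be -1, the super case. -/
theorem trivial_of_finrank_eq_three (hB : Module.finrank k B = 3) :
    (∀ b, S.actG b = b) ∨ ∀ b, S.grade b = b := by
  by_contra! hcon
  obtain ⟨⟨x, hx⟩, ⟨y, hy⟩⟩ := hcon
  obtain ⟨z, hz, hz0⟩ := exists_notMem_span_singleton (ε := counit (R := k) (A := B)) hB 0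
  obtain ⟨u, hu, hu0, hσu, hγu⟩ := S.exists_eigenvector hz hz0
  obtain ⟨z, hz, hzu⟩ := exists_notMem_span_singleton (ε := counit (R := k) (A := B)) hB u
  obtain ⟨v, hv, hvu, hσv, hγv⟩ := S.exists_eigenvector hz hzu
  have hu0 : u ≠ 0 := by
    rintro rfl
    exact hu0 (Submodule.zero_mem _)
  have sign : ∀ {f : B →ₗ[k] B} {w : B}, (f w = w ∨ f w = -w) →
      ∃ r : k, (r = 1 ∨ r = -1) ∧ f w = r • w := fun {f w} h => h.elim
    (fun h => ⟨1, .inl rfl, by rw [h, one_smul]⟩)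
    (fun h => ⟨-1, .inr rfl, by rw [h, neg_one_smul]⟩)
  obtain ⟨su, hsu, hσu⟩ := sign hσu
  obtain ⟨sv, hsv, hσv⟩ := sign hσv
  obtain ⟨tu, htu, hγu⟩ := sign hγu
  obtain ⟨tv, htv, hγv⟩ := sign hγv
  have hbasis : ∀ {u v : B}, counit (R := k) u = 0 → counit (R := k) v = 0 → u ≠ 0 →
      v ∉ Submodule.span k {u} → ∃ β : Module.Basis (Fin 3) k B, β 0 = 1 ∧ β 1 = u ∧ β 2 = v ∧
        ∀ x, β.coord 0 x = counit (R := k) x := fun {u v} hu hv hu0 hvu => by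
    obtain ⟨β, h0, h1, h2⟩ := exists_basis_of_functional S.counit_one hB hu hv hu0 hvu
    exact ⟨β, h0, h1, h2, coord_zero_eq_counit S.counit_one h0 (by rw [h1, hu]) (by rw [h2, hv])⟩
  obtain ⟨β, h0, h1, h2, hβ⟩ := hbasis hu hv hu0 hvu
  have hdiag : ∀ {f : B →ₗ[k] B} {a c : k}, f 1 = 1 → f u = a • u → f v = c • v →
      ∀ i, f (β i) = (![1, a, c] : Fin 3 → k) i • β i := fun {f a c} hf1 hfu hfv i => by
    fin_cases i
    · simp [h0, hf1]
    · simp [h1, hfu]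
    · simp [h2, hfv]
  have hσ := hdiag S.actG_one hσu hσv
  have hγ := hdiag S.grade_one hγu hγv
  have hid : ∀ {f : B →ₗ[k] B}, (∀ i, f (β i) = (![1, 1, 1] : Fin 3 → k) i • β i) → ∀ b, f b = b :=
    fun {f} hf b => by
      have : f = LinearMap.id := β.ext fun i => by
        rw [hf]
        fin_cases i <;> simp
      rw [this, LinearMap.id_apply]
  have hvec : ∀ {a c : k}, (a = 1 ∨ a = -1) → (c = 1 ∨ c = -1) →
      ∀ i, (![1, a, c] : Fin 3 → k) i = 1 ∨ (![1, a, c] : Fin 3 → k) i = -1 := by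
    intro a c ha hc i
    fin_cases i
    · simp
    · simpa using ha
    · simpa using hc
  by_cases hu1 : su = 1 ∧ tu = 1
  · obtain ⟨rfl, rfl⟩ := hu1
    rcases hsv with rfl | rfl
    · exact hx (hid hσ x)
    rcases htv with rfl | rfl
    · exact hy (hid hγ y)
    have hv0 : v ≠ 0 := by
      rintro rfl
      exact hvu (Submodule.zero_mem _)
    -- The basis is reordered, since `false_of_super` expects the odd vector at index 1.
    have huv : u ∉ Submodule.span k {v} := fun h => by
      obtain ⟨r, hr⟩ := Submodule.mem_span_singleton.1 h
      have hr0 : r ≠ 0 := by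
        rintro rfl
        rw [zero_smul] at hr
        exact hu0 hr.symm
      refine hvu (Submodule.mem_span_singleton.2 ⟨r⁻¹, ?_⟩)
      rw [← hr, smul_smul, inv_mul_cancel₀ hr0, one_smul]
    obtain ⟨β', h0', h1', h2', hβ'⟩ := hbasis hv hu hv0 huv
    refine false_of_super (S := S) h0' hβ' (s := ![1, -1, 1]) rfl rfl (fun i => ?_) fun i => ?_
    · fin_cases i
      · simp [h0', S.actG_one]
      · simp [h1', hσv]
      · simp [h2', hσu]
    · fin_cases i
      · simp [h0', S.grade_one]
      · simp [h1', hγv]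
      · simp [h2', hγu]
  by_cases hv1 : sv = 1 ∧ tv = 1
  · obtain ⟨rfl, rfl⟩ := hv1
    rcases hsu with rfl | rfl
    · exact hx (hid hσ x)
    rcases htu with rfl | rfl
    · exact hy (hid hγ y)
    exact false_of_super (S := S) h0 hβ rfl rfl hσ hγ
  refine false_of_no_invariants (S := S) h0 hβ hσ hγ (hvec hsu hsv) (hvec htu htv) fun i hi => ?_
  fin_cases i
  · exact absurd rfl hi
  · simpa using hu1
  · simpa using hv1

end BraidedHopfAlgebra

end NontrivialBraiding

/-! ### The three biproducts -/

section Biproducts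

open Coalgebra

variable {k : Type*} [Field k]

/-- An isomorphism of Hopf algebra structures can be checked on a basis of group elements. -/
theorem HopfOps.isIso_of_single {A : Type*} [AddCommGroup A] [Module k A]
    {S : HopfOps k (GA k (C 3) ⊗[k] GA k (C 2))} {T : HopfOps k A}
    {e : GA k (C 3) ⊗[k] GA k (C 2) ≃ₗ[k] A} {u : C 3 → C 2 → GA k (C 3) ⊗[k] GA k (C 2)}
    (hu : ∀ a c, u a c = MonoidAlgebra.single a 1 ⊗ₜ MonoidAlgebra.single c 1)
    (hmul : ∀ a c a' c', e (S.mul (u a c ⊗ₜ u a' c')) = T.mul (e (u a c) ⊗ₜ e (u a' c')))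
    (hone : e S.one = T.one)
    (hcomul : ∀ a c, T.comul (e (u a c)) =
      TensorProduct.map e.toLinearMap e.toLinearMap (S.comul (u a c)))
    (hcounit : ∀ a c, T.counit (e (u a c)) = S.counit (u a c))
    (hantipode : ∀ a c, e (S.antipode (u a c)) = T.antipode (e (u a c))) : S.IsIso T e where
  map_mul x y := by
    have h : e.toLinearMap ∘ₗ S.mul = T.mul ∘ₗ TensorProduct.map e.toLinearMap e.toLinearMap :=
      TensorProduct.ext (TensorProduct.ext (lext k fun a => lext k fun c =>
        TensorProduct.ext (lext k fun a' => lext k fun c' => by simpa [hu] using hmul a c a' c')))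
    exact LinearMap.congr_fun h (x ⊗ₜ y)
  map_one := hone
  map_comul x := by
    have h : T.comul ∘ₗ e.toLinearMap =
        TensorProduct.map e.toLinearMap e.toLinearMap ∘ₗ S.comul :=
      TensorProduct.ext (lext k fun a => lext k fun c => by simpa [hu] using hcomul a c)
    exact LinearMap.congr_fun h x
  map_counit x := by
    have h : T.counit ∘ₗ e.toLinearMap = S.counit :=
      TensorProduct.ext (lext k fun a => lext k fun c => by simpa [hu] using hcounit a c)
    exact LinearMap.congr_fun h x
  map_antipode x := by
    have h : e.toLinearMap ∘ₗ S.antipode = T.antipode ∘ₗ e.toLinearMap :=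
      TensorProduct.ext (lext k fun a => lext k fun c => by simpa [hu] using hantipode a c)
    exact LinearMap.congr_fun h x

/-- The linear equivalence `k[C₃] ⊗ k[C₂] ≃ k[G]` given by a bijection `C₃ × C₂ ≃ G`. -/
def tensorEquiv {G : Type} (φ : C 3 × C 2 ≃ G) : GA k (C 3) ⊗[k] GA k (C 2) ≃ₗ[k] GA k G :=
  ((MonoidAlgebra.basis (C 3) k).tensorProduct (MonoidAlgebra.basis (C 2) k)).equiv
    (MonoidAlgebra.basis G k) φ

theorem tensorEquiv_single {G : Type} (φ : C 3 × C 2 ≃ G) (a : C 3) (c : C 2) :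
    tensorEquiv (k := k) φ (MonoidAlgebra.single a 1 ⊗ₜ MonoidAlgebra.single c 1) =
      MonoidAlgebra.single (φ (a, c)) 1 := by
  have h := ((MonoidAlgebra.basis (C 3) k).tensorProduct (MonoidAlgebra.basis (C 2) k)).equiv_apply
    (a, c) (MonoidAlgebra.basis G k) φ
  rwa [Module.Basis.tensorProduct_apply] at h

theorem biproduct_BC6_isomorphic :
    (biproduct (BC6 k)).Isomorphic (HopfOps.ofHopf k (MonoidAlgebra k (C 6))) := by
  -- Chinese remainder theorem: 4 is (1, 0) and 3 is (0, 1) modulo (3, 2).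
  let φ : C 3 × C 2 ≃ C 6 := Equiv.ofBijective
    (fun p => Multiplicative.ofAdd (4 * p.1.toAdd.val + 3 * p.2.toAdd.val : ZMod 6)) (by decide)
  have hmul : ∀ a a' c c', φ (a * a', c * c') = φ (a, c) * φ (a', c') := by decide
  have hone : φ (1, 1) = 1 := by decide
  have hinv : ∀ a c, φ (a⁻¹, c⁻¹) = (φ (a, c))⁻¹ := by decide
  refine ⟨tensorEquiv φ, HopfOps.isIso_of_single (fun _ _ => rfl) ?_ ?_ ?_ ?_ ?_⟩
  · intro a c a' c'
    simp [biproduct, HopfOps.ofHopf, smashMul, middle, crossMap, BC6, actMap, trivialAct_apply,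
      tensorEquiv_single, hmul]
  · simp [biproduct, HopfOps.ofHopf, MonoidAlgebra.one_def, tensorEquiv_single, hone]
  · intro a c
    simp [biproduct, HopfOps.ofHopf, smashComul, middle, crossMap, BC6, trivialCoact_apply,
      tensorEquiv_single]
  · intro a c
    simp [biproduct, HopfOps.ofHopf, tensorEquiv_single]
  · intro a c
    simp [biproduct, HopfOps.ofHopf, smashMul, middle, crossMap, BC6, actMap, trivialAct_apply,
      trivialCoact_apply, tensorEquiv_single, hinv]

theorem biproduct_BS3_isomorphic :
    (biproduct (BS3 k)).Isomorphic (HopfOps.ofHopf k (MonoidAlgebra k (Equiv.Perm (Fin 3)))) := by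
  let φ : C 3 × C 2 ≃ Equiv.Perm (Fin 3) := Equiv.ofBijective
    (fun p => finRotate 3 ^ p.1.toAdd.val * Equiv.swap 1 2 ^ p.2.toAdd.val) (by decide)
  -- The semidirect product law: the transposition conjugates a rotation to its inverse, which is
  -- its square.
  have hmul : ∀ a a' c c', φ (if c = 1 then a * a' else a * a' ^ 2, c * c') =
    φ (a, c) * φ (a', c') := by decide
  have hone : φ (1, 1) = 1 := by decide
  have hinv : ∀ a c, φ (if c⁻¹ = 1 then a⁻¹ else a⁻¹ ^ 2, c⁻¹) = (φ (a, c))⁻¹ := by decide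
  refine ⟨tensorEquiv φ, HopfOps.isIso_of_single (fun _ _ => rfl) ?_ ?_ ?_ ?_ ?_⟩
  · intro a c a' c'
    simp [biproduct, HopfOps.ofHopf, smashMul, middle, crossMap, BS3, actMap, sqAct_single,
      tensorEquiv_single, ← hmul]
  · simp [biproduct, HopfOps.ofHopf, MonoidAlgebra.one_def, tensorEquiv_single, hone]
  · intro a c
    simp [biproduct, HopfOps.ofHopf, smashComul, middle, crossMap, BS3, trivialCoact_apply,
      tensorEquiv_single]
  · intro a c
    simp [biproduct, HopfOps.ofHopf, tensorEquiv_single]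
  · intro a c
    simp [biproduct, HopfOps.ofHopf, smashMul, middle, crossMap, BS3, actMap, sqAct_single,
      trivialCoact_apply, tensorEquiv_single, ← hinv]

/-! ### The third biproduct and functions on S₃. -/

section Dual

variable {ω : k} (hω : ω ^ 3 = 1)

/-- The restriction of a character of `k[C₂]` to the two values `±1` of the signature. -/
def signChar (σ : Equiv.Perm (Fin 3)) : GA k (C 2) →ₐ[k] k :=
  if Equiv.Perm.sign σ = 1 then Bialgebra.counitAlgHom k (GA k (C 2)) else sgn k

/-- The value of `xⁱ ⊗ gʲ` at a permutation, in the identification of `k[C₃] ⊗ k[C₂]` with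
functions on `S₃`. -/
def evalPerm (σ : Equiv.Perm (Fin 3)) : GA k (C 3) ⊗[k] GA k (C 2) →ₐ[k] k :=
  Algebra.TensorProduct.lift
    (MonoidAlgebra.lift k k (C 3) ((powHom hω).comp (powMonoidHom (σ 0 : ℕ))))
    (signChar σ) fun _ _ => .all ..

theorem evalPerm_tmul (σ : Equiv.Perm (Fin 3)) (a : C 3) (h : GA k (C 2)) :
    evalPerm hω σ (MonoidAlgebra.single a 1 ⊗ₜ h) = powHom hω (a ^ (σ 0 : ℕ)) * signChar σ h := by
  simp [evalPerm]

theorem signChar_mul_single (σ τ : Equiv.Perm (Fin 3)) (c : C 2) :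
    signChar (k := k) (σ * τ) (MonoidAlgebra.single c 1) =
      signChar σ (MonoidAlgebra.single c 1) * signChar τ (MonoidAlgebra.single c 1) := by
  have h1 : sgn k (MonoidAlgebra.single 1 1) = 1 := map_one _
  rcases eq_one_or_eq_g c with rfl | rfl <;>
  rcases Int.units_eq_one_or (Equiv.Perm.sign σ) with h | h <;>
  rcases Int.units_eq_one_or (Equiv.Perm.sign τ) with h' | h' <;>
  simp [signChar, h, h', sgn_g, h1]

/-- A permutation of three points is determined by its sign and its value at 0. The value is read
off from ω^(σ 0) on x ⊗ 1, the sign from 1 ⊗ g. -/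
theorem evalPerm_injective [CharZero k] (hω1 : IsPrimitiveRoot ω 3) :
    Function.Injective (evalPerm (k := k) hω) := by
  have key : ∀ σ τ : Equiv.Perm (Fin 3), σ 0 = τ 0 → Equiv.Perm.sign σ = Equiv.Perm.sign τ →
      σ = τ := by decide
  intro σ τ h
  have h1 := congrArg (fun f => f (MonoidAlgebra.single (Multiplicative.ofAdd 1) 1 ⊗ₜ 1)) h
  have h2 := congrArg (fun f => f (1 ⊗ₜ MonoidAlgebra.single g 1)) h
  simp only [MonoidAlgebra.one_def, evalPerm_tmul, one_pow, map_one, one_mul] at h2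
  simp only [evalPerm_tmul, map_one, mul_one, map_pow, powHom, MonoidHom.coe_mk, OneHom.coe_mk,
    toAdd_ofAdd, ZMod.val_one, pow_one] at h1
  refine key σ τ (Fin.ext (hω1.pow_inj (σ 0).2 (τ 0).2 h1)) ?_
  have h3 : (-1 : k) ≠ 1 := by norm_num
  rcases Int.units_eq_one_or (Equiv.Perm.sign σ) with h | h <;>
  rcases Int.units_eq_one_or (Equiv.Perm.sign τ) with h' | h' <;>
  simp [signChar, h, h', sgn_g, h3, h3.symm] at h2 ⊢

/-- The identification of `k[C₃] ⊗ k[C₂]` with the functions on `S₃`. -/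
def functionEquiv [CharZero k] (hω1 : IsPrimitiveRoot ω 3) :
    GA k (C 3) ⊗[k] GA k (C 2) ≃ₗ[k] Module.Dual k (GA k (Equiv.Perm (Fin 3))) :=
  (LinearEquiv.ofInjectiveOfFinrankEq
    (LinearMap.pi fun σ => (evalPerm hω σ).toLinearMap)
    (pi_injective_of_linearIndependent
      ((linearIndependent_algHom_toLinearMap k _ k).comp _ (evalPerm_injective hω hω1))
      (by
        rw [Module.finrank_eq_card_basis ((MonoidAlgebra.basis (C 3) k).tensorProduct
          (MonoidAlgebra.basis (C 2) k))]
        rfl))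
    (by
      rw [Module.finrank_eq_card_basis ((MonoidAlgebra.basis (C 3) k).tensorProduct
        (MonoidAlgebra.basis (C 2) k)), Module.finrank_fintype_fun_eq_card]
      rfl)).trans ((MonoidAlgebra.basis (Equiv.Perm (Fin 3)) k).constr k)

theorem functionEquiv_apply_single [CharZero k] (hω1 : IsPrimitiveRoot ω 3)
    (t : GA k (C 3) ⊗[k] GA k (C 2)) (σ : Equiv.Perm (Fin 3)) :
    functionEquiv hω hω1 t (MonoidAlgebra.single σ 1) = evalPerm hω σ t :=
  (MonoidAlgebra.basis (Equiv.Perm (Fin 3)) k).constr_basis k _ σ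

theorem signChar_pPlus [CharZero k] (σ : Equiv.Perm (Fin 3)) :
    signChar σ (pPlus k) = if Equiv.Perm.sign σ = 1 then 1 else 0 := by
  unfold signChar
  split_ifs
  · exact counit_pPlus k
  · exact sgn_pPlus k

theorem signChar_pMinus [CharZero k] (σ : Equiv.Perm (Fin 3)) :
    signChar σ (pMinus k) = if Equiv.Perm.sign σ = 1 then 0 else 1 := by
  unfold signChar
  split_ifs
  · exact counit_pMinus k
  · exact sgn_pMinus k

theorem antipode_pPlus : HopfAlgebra.antipode k (pPlus k) = pPlus k := by
  simp only [pPlus, map_smul, map_add, HopfAlgebra.antipode_one, MonoidAlgebra.of_apply,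
    MonoidAlgebra.antipode_single, show g⁻¹ = g by decide, HopfAlgebra.antipode_one]

theorem antipode_pMinus : HopfAlgebra.antipode k (pMinus k) = pMinus k := by
  simp only [pMinus, map_smul, map_sub, HopfAlgebra.antipode_one, MonoidAlgebra.of_apply,
    MonoidAlgebra.antipode_single, show g⁻¹ = g by decide, HopfAlgebra.antipode_one]

theorem smashMul_BStar [CharZero k] (h : GA k (C 2)) (b : GA k (C 3)) :
    smashMul (BStar k) ((1 ⊗ₜ h) ⊗ₜ (b ⊗ₜ 1)) = b ⊗ₜ h := by
  refine LinearMap.congr_fun (LinearMap.congr_fun (f := LinearMap.mk₂ k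
    (fun h b => smashMul (BStar k) ((1 ⊗ₜ h) ⊗ₜ (b ⊗ₜ 1)))
    (by intros; simp [tmul_add, add_tmul]) (by intros; simp [tmul_smul, ← smul_tmul'])
    (by intros; simp [tmul_add, add_tmul]) (by intros; simp [tmul_smul, ← smul_tmul']))
    (g := (TensorProduct.mk k _ _).flip) (lext k fun c => lext k fun a => ?_) h) b
  simp [smashMul, middle, crossMap, BStar, actMap, trivialAct_apply]

theorem biproduct_BStar_antipode [CharZero k] (a : C 3) (c : C 2) :
    (biproduct (BStar k)).antipode (MonoidAlgebra.single a 1 ⊗ₜ MonoidAlgebra.single c 1) =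
      MonoidAlgebra.single a⁻¹ 1 ⊗ₜ (MonoidAlgebra.single c⁻¹ 1 * pPlus k) +
      MonoidAlgebra.single (a ^ 2)⁻¹ 1 ⊗ₜ (MonoidAlgebra.single c⁻¹ 1 * pMinus k) := by
  have h : crossMap (BStar k).coact (LinearMap.mul' k (GA k (C 2)))
      (MonoidAlgebra.single a 1 ⊗ₜ MonoidAlgebra.single c 1) =
      (pPlus k * MonoidAlgebra.single c 1) ⊗ₜ MonoidAlgebra.single a 1 +
      (pMinus k * MonoidAlgebra.single c 1) ⊗ₜ MonoidAlgebra.single (a ^ 2) 1 := by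
    simp [crossMap, BStar, sqCoact_single, add_tmul]
  have hS : ∀ b, (BStar k).antipode b = HopfAlgebra.antipode k b := fun _ => rfl
  simp only [biproduct, LinearMap.comp_apply, h, map_add, TensorProduct.map_tmul, hS,
    TensorProduct.mk_apply, LinearMap.flip_apply, smashMul_BStar, HopfAlgebra.antipode_mul_distrib,
    antipode_pPlus, antipode_pMinus, MonoidAlgebra.antipode_single, HopfAlgebra.antipode_one]
  simp [mul_comm]

theorem inv_eq_self : ∀ c : C 2, c⁻¹ = c := by decide

theorem biproduct_BStar_isomorphic [IsAlgClosed k] [CharZero k] : (biproduct (BStar k)).Isomorphic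
    (HopfOps.dual k (MonoidAlgebra k (Equiv.Perm (Fin 3)))) := by
  obtain ⟨ω, hω1⟩ : ∃ ω : k, IsPrimitiveRoot ω 3 := HasEnoughRootsOfUnity.exists_primitiveRoot k 3
  have hω := hω1.pow_eq_one
  -- Modulo 3, σ(j) = σ(0) ± j with the sign of σ. The coaction matches this: a character of C₂
  -- attached to σ sends p₊ to 1 for σ even and p₋ to 1 for σ odd.
  have hact : ∀ (σ τ : Equiv.Perm (Fin 3)) (a : C 3), a ^ ((σ * τ) 0 : ℕ) =
      a ^ (σ 0 : ℕ) * (if Equiv.Perm.sign σ = 1 then a else a ^ 2) ^ (τ 0 : ℕ) := by decide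
  -- For σ even, σ⁻¹(0) = -σ(0) modulo 3; an odd σ is its own inverse, and (a²)⁻¹ = a.
  have hinv : ∀ (σ : Equiv.Perm (Fin 3)) (a : C 3), a ^ (σ⁻¹ 0 : ℕ) =
      (if Equiv.Perm.sign σ = 1 then a⁻¹ else (a ^ 2)⁻¹) ^ (σ 0 : ℕ) := by decide
  have hdual : ∀ {x y : Module.Dual k (GA k (Equiv.Perm (Fin 3)))},
      (∀ σ, x (MonoidAlgebra.single σ 1) = y (MonoidAlgebra.single σ 1)) → x = y := fun h => lext k h
  refine ⟨functionEquiv hω hω1, HopfOps.isIso_of_single (fun _ _ => rfl) ?_ ?_ ?_ ?_ ?_⟩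
  · intro a c a' c'
    refine hdual fun σ => ?_
    simp [biproduct, HopfOps.dual, smashMul, middle, crossMap, BStar, actMap, trivialAct_apply,
      functionEquiv_apply_single, ← map_mul]
  · refine hdual fun σ => ?_
    simp [biproduct, HopfOps.dual, functionEquiv_apply_single, ← Algebra.TensorProduct.one_def]
  · intro a c
    apply (TensorProduct.dualDistribEquiv k _ _).injective
    have hd : ∀ (t : (GA k (C 3) ⊗[k] GA k (C 2)) ⊗[k] (GA k (C 3) ⊗[k] GA k (C 2))) σ τ,
        TensorProduct.dualDistribEquiv k _ _ (TensorProduct.map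
          (functionEquiv hω hω1).toLinearMap (functionEquiv hω hω1).toLinearMap t)
          (MonoidAlgebra.single σ 1 ⊗ₜ MonoidAlgebra.single τ 1) =
        LinearMap.mul' k k (TensorProduct.map (evalPerm hω σ).toLinearMap
          (evalPerm hω τ).toLinearMap t) := fun t σ τ => by
      induction t with
      | zero => simp
      | tmul x y => simp [functionEquiv_apply_single, TensorProduct.dualDistribEquiv]
      | add x y hx hy => simp only [map_add, LinearMap.add_apply, hx, hy]
    refine TensorProduct.ext (lext k fun σ => lext k fun τ => ?_)
    refine Eq.trans ?_ (hd _ σ τ).symm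
    have hl : TensorProduct.dualDistribEquiv k _ _ ((HopfOps.dual k (GA k (Equiv.Perm (Fin 3)))).comul
        (functionEquiv hω hω1 (MonoidAlgebra.single a 1 ⊗ₜ MonoidAlgebra.single c 1)))
        (MonoidAlgebra.single σ 1 ⊗ₜ MonoidAlgebra.single τ 1) =
        evalPerm hω (σ * τ) (MonoidAlgebra.single a 1 ⊗ₜ MonoidAlgebra.single c 1) := by
      refine (LinearMap.congr_fun (LinearEquiv.apply_symm_apply _ _) _).trans ?_
      simp [functionEquiv_apply_single]
    refine hl.trans ?_
    rw [evalPerm_tmul, hact]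
    simp only [biproduct, smashComul, middle, crossMap, BStar, signChar_mul_single]
    simp [sqCoact_single, tmul_add, add_tmul, evalPerm_tmul, signChar_pPlus, signChar_pMinus]
    split_ifs <;> simp <;> ring
  · intro a c
    simp [biproduct, HopfOps.dual, functionEquiv_apply_single, MonoidAlgebra.one_def, evalPerm_tmul,
      signChar]
  · intro a c
    refine hdual fun σ => ?_
    have hl : (HopfOps.dual k (GA k (Equiv.Perm (Fin 3)))).antipode
        (functionEquiv hω hω1 (MonoidAlgebra.single a 1 ⊗ₜ MonoidAlgebra.single c 1))
        (MonoidAlgebra.single σ 1) =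
        evalPerm hω σ⁻¹ (MonoidAlgebra.single a 1 ⊗ₜ MonoidAlgebra.single c 1) := by
      simp [HopfOps.dual, functionEquiv_apply_single]
    have hs : signChar (k := k) σ⁻¹ = signChar σ := by simp only [signChar, Equiv.Perm.sign_inv]
    rw [functionEquiv_apply_single]
    refine (congrArg (evalPerm hω σ) (biproduct_BStar_antipode a c)).trans (Eq.trans ?_ hl.symm)
    rw [evalPerm_tmul, hinv, hs, inv_eq_self c, map_add, evalPerm_tmul, evalPerm_tmul, map_mul,
      map_mul, signChar_pPlus, signChar_pMinus]
    split_ifs <;> simp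

end Dual

end Biproducts

end YD

end

theorem mainTheorem9 {k : Type*} [Field k] [IsAlgClosed k] [CharZero k] :
    (∀ {B : Type*} [Ring B] [Algebra k B] [Coalgebra k B]
        (S : YD.BraidedHopfAlgebra k (MonoidAlgebra k (YD.C 2)) B),
        Module.finrank k B = 3 →
          Nonempty (S.Iso (YD.BC6 k)) ∨ Nonempty (S.Iso (YD.BS3 k)) ∨
            Nonempty (S.Iso (YD.BStar k))) ∧
      (YD.biproduct (YD.BC6 k)).Isomorphic
        (YD.HopfOps.ofHopf k (MonoidAlgebra k (YD.C 6))) ∧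
      (YD.biproduct (YD.BS3 k)).Isomorphic
        (YD.HopfOps.ofHopf k (MonoidAlgebra k (Equiv.Perm (Fin 3)))) ∧
      (YD.biproduct (YD.BStar k)).Isomorphic
        (YD.HopfOps.dual k (MonoidAlgebra k (Equiv.Perm (Fin 3)))) :=
  ⟨fun S hB => YD.nonempty_iso_of_trivial S hB
    (YD.BraidedHopfAlgebra.trivial_of_finrank_eq_three S hB),
    YD.biproduct_BC6_isomorphic, YD.biproduct_BS3_isomorphic, YD.biproduct_BStar_isomorphic⟩
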